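/- Let $1\le k\le n-1$ and let $\mathbb P^n$ be the complex projective space of lines in $\mathbb C^{n+1}$, with homogeneous coordinates $X_0,\dots,X_n$, hyperplane at infinity $C^0=\{X_0=0\}$, and affine part $U^0=\mathbb P^n\setminus C^0=\mathbb C^k\times\mathbb C^{n-k}$ with affine coordinates $x_1,\dots,x_k,y_1,\dots,y_{n-k}$. Define the data schemes $b_r:D^r_k\mathbb P^n\to D^{r-1}_k\mathbb P^n$ inductively: $D^0_k\mathbb P^n=\mathbb P^n$, $\mathcal F_0=T\mathbb P^n$, and, for $r\ge1$, $D^r_k\mathbb P^n=\mathrm{Gr}_k(\mathcal F_{r-1})$ is the Grassmann bundle of $k$-planes $W$ in $\mathcal F_{r-1}\subseteq TD^{r-1}_k\mathbb P^n$, while $\mathcal F_r\subseteq TD^r_k\mathbb P^n$ is the bundle whose fibre at $W$ is $(Tb_r)^{-1}(W)$. Let $C^1$ be the closure of the locus of $k$-planes at points of $U^0$ that meet the subbundle $Y=\{dx_1=\dots=dx_k=0\}$ of $TU^0$ nontrivially; for $r\ge2$ let $C^r\subseteq D^r_k\mathbb P^n$ be the locus of $k$-planes that meet the relative tangent bundle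 $\ker(Tb_{r-1})\subseteq \mathcal F_{r-1}$ nontrivially. Let $C^r_s\subseteq D^r_k\mathbb P^n$ be the preimage of $C^s$ for $0\le s\le r$, and put $U^r=D^r_k\mathbb P^n\setminus(C^r_0\cup\dots\cup C^r_r)$, an open subscheme. Then the affine coordinates on $U^0$ induce isomorphisms of schemes, for every $r\ge1$, $$U^r\;\cong\;U^{r-1}\times\mathrm{Hom}\bigl((\mathbb C^k)^{\otimes r},\mathbb C^{n-k}\bigr),$$ whose first component is $b_r$. Consequently, for every $r\ge 0$, $U^r$ is isomorphic to a cartesian power of $\mathbb C$, with coordinates $x_i$, $y_j$ and $y^j_{i_1,\dots,i_s}$ for $1\le s\le r$, $1\le j\le n-k$ and arbitrary indices $1\le i_1,\dots,i_s\le k$ (symbols that differ by the order of the indices are distinct coordinates). Here the coordinates with $s<r$ are pulled back from $U^{r-1}$; those with $s=r$ are the matrix entries $h\mapsto h(e_{i_1}\otimes\dots\otimes e_{i_r})_j$ of the component in $\mathrm{Hom}((\mathbb C^k)^{\otimes r},\mathbb C^{n-k})$; and $y^j_{i_1,\dots,i_s}$ is the formal derivative $\partial y^j_{i_1,\dots,i_{s-1}}/\partial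 x_{i_s}$, in the sense that at a point of $U^r$ the corresponding $k$-plane $W\subseteq TU^{r-1}$ is given by the equations $$dy^j_{i_1,\dots,i_s}=\sum_{i=1}^k y^j_{i_1,\dots,i_s,i}\,dx_i\qquad(0\le s\le r-1,\ 1\le j\le n-k,\ 1\le i_1,\dots,i_s\le k),$$ where for $s=0$ the symbol $y^j_{i_1,\dots,i_s}$ means $y_j$. -/

import Mathlib

open CategoryTheory TensorProduct TrivSqZeroExt

noncomputable section

namespace DataScheme

/-!
A scheme over `ℂ` is described by its functor of points on commutative `ℂ`-algebras.
An `A`-valued tangent vector of `D` is a point of `D` with values in the dual numbers `A[ε]`, lying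
over a point of `D` with values in `A`.
-/

/-- Commutative `ℂ`-algebras. -/
abbrev Alg := CommAlgCat.{0} ℂ

/-- Functors of points. -/
abbrev Space := Alg ⥤ Type 1

/-! ### Dual numbers and frames -/

/-- The dual numbers `A[ε]`. -/
abbrev dual (A : Alg) : Alg := CommAlgCat.of ℂ (DualNumber A)

/-- The algebra `A[ε₁, …, ε_k]` with all products `ε_i ε_j` equal to zero. -/
abbrev multiDual (k : ℕ) (A : Alg) : Alg := CommAlgCat.of ℂ (TrivSqZeroExt A (Fin k → A))

/-- The reduction `ε ↦ 0`. -/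
def dualFst (A : Alg) : dual A ⟶ A := CommAlgCat.ofHom (TrivSqZeroExt.fstHom ℂ A A)

/-- The inclusion of constants `A → A[ε]`. -/
def dualInl (A : Alg) : A ⟶ dual A := CommAlgCat.ofHom (TrivSqZeroExt.inlAlgHom ℂ A A)

/-- The reduction `ε₁, …, ε_k ↦ 0`. -/
def multiFst (k : ℕ) (A : Alg) : multiDual k A ⟶ A :=
  CommAlgCat.ofHom (TrivSqZeroExt.fstHom ℂ A (Fin k → A))

/-- Extension of `A → B` to `A[ε] → B[ε]` by `ε ↦ ε`. -/
def dualMap {A B : Alg} (φ : A ⟶ B) : dual A ⟶ dual B :=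
  CommAlgCat.ofHom
    { toFun := fun x => (inl (φ.hom x.fst) + inr (φ.hom x.snd) : DualNumber B)
      map_one' := by ext <;> simp
      map_mul' := fun x y => by ext <;> simp
      map_zero' := by ext <;> simp
      map_add' := fun x y => by ext <;> simp
      commutes' := fun c => by ext <;> simp [TrivSqZeroExt.algebraMap_eq_inl'] }

/-- Extension of `A → B` to `A[ε₁, …, ε_k] → B[ε₁, …, ε_k]` by `ε_i ↦ ε_i`. -/
def multiMap (k : ℕ) {A B : Alg} (φ : A ⟶ B) : multiDual k A ⟶ multiDual k B :=
  CommAlgCat.ofHom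
    { toFun := fun x =>
        (inl (φ.hom x.fst) + inr (fun i => φ.hom (x.snd i)) : TrivSqZeroExt B (Fin k → B))
      map_one' := by ext <;> simp
      map_mul' := fun x y => by ext <;> simp
      map_zero' := by ext <;> simp
      map_add' := fun x y => by ext <;> simp
      commutes' := fun c => by ext <;> simp [TrivSqZeroExt.algebraMap_eq_inl'] }

/-- The map `A[ε₁, …, ε_k] → A[ε]`, `ε_i ↦ a_i ε`. A point of a scheme `D` with values in
`A[ε₁, …, ε_k]` is a family of `k` tangent vectors at one point of `D`, and this map sends it to the
linear combination with coefficients `a_i`. -/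
def comb {k : ℕ} {A : Alg} (a : Fin k → A) : multiDual k A ⟶ dual A :=
  CommAlgCat.ofHom
    { toFun := fun x => (inl x.fst + inr (∑ i, a i * x.snd i) : DualNumber A)
      map_one' := by ext <;> simp
      map_mul' := fun x y => by
        ext
        · simp
        · simp only [snd_add, snd_inl, snd_inr, zero_add, snd_mul, fst_add, fst_inl, fst_inr,
            add_zero, smul_eq_mul, MulOpposite.smul_eq_mul_unop, MulOpposite.unop_op,
            Pi.add_apply, Pi.smul_apply, Finset.mul_sum, Finset.sum_mul,
            ← Finset.sum_add_distrib]
          refine Finset.sum_congr rfl fun i _ => ?_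
          ring
      map_zero' := by ext <;> simp
      map_add' := fun x y => by
        ext
        · simp
        · simp [mul_add, Finset.sum_add_distrib]
      commutes' := fun c => by ext <;> simp [TrivSqZeroExt.algebraMap_eq_inl'] }

/-- The localisation map `A → A_f`. -/
def loc (A : Alg) (f : A) : A ⟶ CommAlgCat.of ℂ (Localization.Away f) :=
  CommAlgCat.ofHom (IsScalarTower.toAlgHom ℂ A (Localization.Away f))

/-! ### Grassmann bundles of subbundles of the tangent bundle -/

/-- A scheme `D` with a distinguished subbundle `F` of its tangent bundle; `focal A` is the set of
`A`-valued tangent vectors that lie in `F`. -/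
structure Stage where
  space : Space
  focal : ∀ A : Alg, Set (space.obj (dual A))

/-- An `A`-valued point of the Grassmann bundle `Gr_k F` of rank `k` subbundles of `F ⊆ TD`: a point
`base` of `D`, with a rank `k` subbundle `W` of the pull-back of `F` to `Spec A`. The subbundle is
given by its sections over all `A`-algebras: `carrier φ`, for `φ : A → B`, is the set of the
`B`-valued tangent vectors that belong to the pull-back of `W` to `B`. -/
@[ext]
structure GrPoint (X : Stage) (k : ℕ) (A : Alg) where
  base : X.space.obj A
  carrier : ∀ B : Alg, (A ⟶ B) → Set (X.space.obj (dual B))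
  /-- The elements of `W` are tangent vectors at the point `base`. -/
  tangent : ∀ (B : Alg) (φ : A ⟶ B), ∀ v ∈ carrier B φ,
    X.space.map (dualFst B) v = X.space.map φ base
  /-- `W` is contained in `F`. -/
  le_focal : ∀ (B : Alg) (φ : A ⟶ B), carrier B φ ⊆ X.focal B
  /-- `W` is compatible with base change. -/
  map_mem : ∀ (B C : Alg) (φ : A ⟶ B) (ψ : B ⟶ C), ∀ v ∈ carrier B φ,
    X.space.map (dualMap ψ) v ∈ carrier C (φ ≫ ψ)
  /-- A tangent vector at `base` which belongs to `W` Zariski locally belongs to `W`. -/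
  of_local : ∀ (B : Alg) (φ : A ⟶ B) (v : X.space.obj (dual B)),
    X.space.map (dualFst B) v = X.space.map φ base →
    (∀ P : PrimeSpectrum B, ∃ f : B, f ∉ P.asIdeal ∧
      X.space.map (dualMap (loc B f)) v ∈ carrier _ (φ ≫ loc B f)) →
    v ∈ carrier B φ
  /-- `W` is Zariski locally spanned by `k` tangent vectors which are linearly independent, and
  which remain so after every base change. -/
  exists_frame : ∀ P : PrimeSpectrum A, ∃ f : A, f ∉ P.asIdeal ∧
    ∃ e : X.space.obj (multiDual k (CommAlgCat.of ℂ (Localization.Away f))),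
      X.space.map (multiFst k _) e = X.space.map (loc A f) base ∧
      ∀ (B : Alg) (ψ : CommAlgCat.of ℂ (Localization.Away f) ⟶ B),
        Set.BijOn (fun a : Fin k → B => X.space.map (comb a) (X.space.map (multiMap k ψ) e))
          Set.univ (carrier B (loc A f ≫ ψ))

theorem multiMap_fst (k : ℕ) {A B : Alg} (φ : A ⟶ B) :
    multiMap k φ ≫ multiFst k B = multiFst k A ≫ φ := by
  apply CommAlgCat.hom_ext
  apply AlgHom.ext
  intro x
  simp [multiMap, multiFst]

theorem multiMap_comp (k : ℕ) {A B C : Alg} (φ : A ⟶ B) (ψ : B ⟶ C) :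
    multiMap k (φ ≫ ψ) = multiMap k φ ≫ multiMap k ψ := by
  apply CommAlgCat.hom_ext
  apply AlgHom.ext
  intro x
  ext <;> simp [multiMap]

/-- The map `A_f → B_{φ(f)}` induced by `φ : A → B`. -/
def locMap {A B : Alg} (φ : A ⟶ B) (f : A) :
    CommAlgCat.of ℂ (Localization.Away f) ⟶ CommAlgCat.of ℂ (Localization.Away (φ.hom f)) :=
  CommAlgCat.ofHom
    { Localization.awayMap φ.hom.toRingHom f with
      commutes' := fun c => by
        have h1 : algebraMap ℂ (Localization.Away f) c
            = algebraMap A (Localization.Away f) (algebraMap ℂ A c) :=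
          IsScalarTower.algebraMap_apply _ _ _ _
        have h2 : algebraMap ℂ (Localization.Away (φ.hom f)) c
            = algebraMap B (Localization.Away (φ.hom f)) (algebraMap ℂ B c) :=
          IsScalarTower.algebraMap_apply _ _ _ _
        change Localization.awayMap φ.hom.toRingHom f
          (algebraMap ℂ (Localization.Away f) c) = algebraMap ℂ (Localization.Away (φ.hom f)) c
        rw [h1, h2]
        simp [Localization.awayMap, IsLocalization.Away.map] }

theorem loc_locMap {A B : Alg} (φ : A ⟶ B) (f : A) :
    loc A f ≫ locMap φ f = φ ≫ loc B (φ.hom f) := by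
  apply CommAlgCat.hom_ext
  apply AlgHom.ext
  intro a
  change Localization.awayMap φ.hom.toRingHom f (algebraMap A (Localization.Away f) a)
    = algebraMap B (Localization.Away (φ.hom f)) (φ.hom a)
  simp [Localization.awayMap, IsLocalization.Away.map]

/-- Base change of a point of the Grassmann bundle. -/
def GrPoint.pull {X : Stage} {k : ℕ} {A B : Alg} (p : GrPoint X k A) (φ : A ⟶ B) :
    GrPoint X k B where
  base := X.space.map φ p.base
  carrier C ψ := p.carrier C (φ ≫ ψ)
  tangent C ψ v hv := by
    rw [p.tangent C (φ ≫ ψ) v hv, Functor.map_comp_apply]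
  le_focal C ψ := p.le_focal C (φ ≫ ψ)
  map_mem C D ψ χ v hv := by
    simpa only [Category.assoc] using p.map_mem C D (φ ≫ ψ) χ v hv
  of_local C ψ v hv h := by
    refine p.of_local C (φ ≫ ψ) v ?_ ?_
    · rw [hv, Functor.map_comp_apply]
    · simpa only [Category.assoc] using h
  exists_frame P := by
    obtain ⟨f, hf, e, he, hb⟩ := p.exists_frame (PrimeSpectrum.comap φ.hom.toRingHom P)
    refine ⟨φ.hom f, hf, X.space.map (multiMap k (locMap φ f)) e, ?_, fun C ψ => ?_⟩
    · rw [← Functor.map_comp_apply, multiMap_fst, Functor.map_comp_apply, he,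
        ← Functor.map_comp_apply, loc_locMap, Functor.map_comp_apply]
    · have h := hb C (locMap φ f ≫ ψ)
      rw [← Category.assoc, loc_locMap, Category.assoc, multiMap_comp] at h
      simpa only [Functor.map_comp_apply] using h

/-- The Grassmann bundle `Gr_k F`. -/
def gr (X : Stage) (k : ℕ) : Space where
  obj A := GrPoint X k A
  map φ := ↾fun p => p.pull φ
  map_id A := by
    ext p
    · change X.space.map (𝟙 A) p.base = p.base
      simp
    · rename_i B φ v
      change v ∈ p.carrier B (𝟙 A ≫ φ) ↔ v ∈ p.carrier B φ
      rw [Category.id_comp]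
  map_comp {A B C} φ ψ := by
    ext p
    · change X.space.map (φ ≫ ψ) p.base = X.space.map ψ (X.space.map φ p.base)
      simp
    · rename_i D χ v
      change v ∈ p.carrier D ((φ ≫ ψ) ≫ χ) ↔ v ∈ p.carrier D (φ ≫ ψ ≫ χ)
      rw [Category.assoc]

/-! ### The data schemes of projective space -/

/-- The Grassmann bundle `Gr_k F → D`, with its focal (Semple) bundle: the tangent vectors of
`Gr_k F` at a point `W` whose image in `TD` lies in `W`. -/
def Stage.next (k : ℕ) (X : Stage) : Stage where
  space := gr X k
  focal A := {v : GrPoint X k (dual A) | v.base ∈ (v.pull (dualFst A)).carrier A (𝟙 A)}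

/-- Projective space `ℙⁿ`: its `A`-valued points are the submodules of `A ⊗ ℂⁿ⁺¹` with locally free
quotient of rank `n`, that is, the rank one direct summands (lines). -/
def proj (n : ℕ) : Space :=
  Module.Grassmannian.functor (R := ℂ) (M := Fin (n + 1) → ℂ) n ⋙ uliftFunctor.{1, 0}

/-- The line in `A ⊗ ℂⁿ⁺¹` given by a point of `ℙⁿ`. -/
def line {n : ℕ} {A : Alg} (p : (proj n).obj A) : Submodule A (A ⊗[ℂ] (Fin (n + 1) → ℂ)) :=
  Module.Grassmannian.toSubmodule (ULift.down p)

/-- The data schemes `D^r_k ℙⁿ`, with their Semple bundles (the whole tangent bundle for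
`r = 0`). -/
def stage (n k : ℕ) : ℕ → Stage
  | 0 => ⟨proj n, fun _ => Set.univ⟩
  | r + 1 => (stage n k r).next k

/-- The data scheme `D^r_k ℙⁿ`. -/
abbrev D (n k r : ℕ) : Space := (stage n k r).space

/-- The projection `b_{r+1} : D^{r+1}_k ℙⁿ → D^r_k ℙⁿ`. -/
def b {n k r : ℕ} {A : Alg} (p : (D n k (r + 1)).obj A) : (D n k r).obj A :=
  GrPoint.base (X := stage n k r) (k := k) (A := A) p

/-- The `k`-plane `W` of tangent vectors of `D^r_k ℙⁿ` given by a point of `D^{r+1}_k ℙⁿ`. -/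
def plane {n k r : ℕ} {A : Alg} (p : (D n k (r + 1)).obj A) : Set ((D n k r).obj (dual A)) :=
  GrPoint.carrier (X := stage n k r) (k := k) (A := A) p A (𝟙 A)

/-- The tangent vector `v` is zero: it is constant. -/
def IsZeroVector {F : Space} {A : Alg} (v : F.obj (dual A)) : Prop :=
  F.map (dualFst A ≫ dualInl A) v = v

/-! ### The open sets `U^r`

From here on `n = k + m`, so that `m` is `n - k`. -/

variable {k m : ℕ}

/-- The homogeneous coordinate `X_0` on `A ⊗ ℂⁿ⁺¹`. -/
def X0 (n : ℕ) (A : Alg) : (A ⊗[ℂ] (Fin (n + 1) → ℂ)) →ₗ[A] A :=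
  (AlgebraTensorModule.rid ℂ A A).toLinearMap ∘ₗ
    (LinearMap.proj (R := ℂ) (φ := fun _ : Fin (n + 1) => ℂ) 0).baseChange A

/-- The line `p` is spanned by `(1, x_1, …, x_k, y_1, …, y_m)`: it is the point of the affine part
`ℂ^k × ℂ^m` of projective space, with affine coordinates `x` and `y`. -/
def IsAffinePoint {A : Alg} (p : (proj (k + m)).obj A) (x : Fin k → A) (y : Fin m → A) : Prop :=
  line p = Submodule.span A
    {∑ i : Fin (k + m + 1), (Fin.cons (1 : A) (Fin.append x y) : Fin (k + m + 1) → A) i ⊗ₜ[ℂ]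
      (Pi.single i 1 : Fin (k + m + 1) → ℂ)}

/-- The vertical tangent vectors of `D^r_k ℙⁿ`. For `r = 0` these are the elements of the
subbundle `Y` of `TU^0`: the tangent vectors at points of the affine part along which the
coordinates `x_i` are constant. For `r ≥ 1` these are the elements of the relative tangent bundle
`TD^r_k ℙⁿ / D^{r-1}_k ℙⁿ`, the kernel of the differential of `b_r`. -/
def IsVertical {A : Alg} : (r : ℕ) → (D (k + m) k r).obj (dual A) → Prop
  | 0, v => ∃ (x : Fin k → A) (y : Fin m → DualNumber A),
      IsAffinePoint (A := dual A) v (fun i => (inl (x i) : DualNumber A)) y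
  | _ + 1, v => IsZeroVector (b v)

/-- The point `p` of `D^r_k ℙⁿ`, with values in a field, lies in `C^r`. For `r = 0` this is the
hyperplane at infinity `X_0 = 0`. For `r ≥ 2` it is the locus of the `k`-planes that meet the
relative tangent bundle nontrivially (the cuspidal divisor). For `r = 1` it is the locus of the
`k`-planes at points of `U^0` that meet `Y` nontrivially (the part of `C^1` over `U^0`). -/
def InC {K : Alg} : (r : ℕ) → (D (k + m) k r).obj K → Prop
  | 0, p => ∀ v ∈ line (n := k + m) (A := K) p, X0 (k + m) K v = 0
  | r + 1, p => ∃ v ∈ plane p, ¬ IsZeroVector v ∧ IsVertical r v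

/-- The point `p` of `D^r_k ℙⁿ` lies in `C^r_s`, the preimage of `C^s`. -/
def InCrs {K : Alg} : (r s : ℕ) → (D (k + m) k r).obj K → Prop
  | 0, s, p => s = 0 ∧ InC 0 p
  | r + 1, s, p => (s = r + 1 ∧ InC (r + 1) p) ∨ (s ≤ r ∧ InCrs r s (b p))

variable (k m) in
/-- `U^r`, the open complement of `C^r_0 ∪ … ∪ C^r_r` in `D^r_k ℙⁿ`: an `A`-valued point belongs to
it when none of the points with values in a field that it induces lies in a `C^r_s`. -/
def UOpen (r : ℕ) : Subfunctor (D (k + m) k r) where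
  obj A := {p | ∀ (K : Alg) (φ : A ⟶ K), IsField K → ∀ s ≤ r,
    ¬ InCrs r s ((D (k + m) k r).map φ p)}
  map φ p hp K ψ hK s hs := by
    rw [← Functor.map_comp_apply]
    exact hp K (φ ≫ ψ) hK s hs

variable (k m) in
/-- The scheme `U^r`. -/
abbrev U (r : ℕ) : Space := (UOpen k m r).toFunctor

/-! ### Coordinates -/

variable (k m) in
/-- The coordinate symbols of order at most `r`: `x_i`, and `y^j_{i_1, …, i_s}` for
`0 ≤ s ≤ r`, where the symbol with `s = 0` is `y_j`. -/
inductive Coord (r : ℕ) : Type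
  | x (i : Fin k) : Coord r
  | y (s : ℕ) (hs : s ≤ r) (I : Fin s → Fin k) (j : Fin m) : Coord r

/-- The affine space with coordinates indexed by `ι`: the functor `A ↦ A^ι`. -/
def affineSpace (ι : Type) : Space where
  obj A := ULift.{1} (ι → A)
  map φ := ↾fun a => ⟨fun i => φ.hom (a.down i)⟩

/-- A complex vector space `H` as a scheme: the functor `A ↦ A ⊗ H`. -/
def vectorSpace (H : Type) [AddCommGroup H] [Module ℂ H] : Space where
  obj A := ULift.{1} (A ⊗[ℂ] H)
  map φ := ↾fun h => ⟨LinearMap.rTensor H φ.hom.toLinearMap h.down⟩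
  map_id A := by
    ext h
    change LinearMap.rTensor H (LinearMap.id : A →ₗ[ℂ] A) h.down = h.down
    simp
  map_comp {A B C} φ ψ := by
    ext h
    change LinearMap.rTensor H (ψ.hom.toLinearMap ∘ₗ φ.hom.toLinearMap) h.down =
      LinearMap.rTensor H ψ.hom.toLinearMap (LinearMap.rTensor H φ.hom.toLinearMap h.down)
    rw [LinearMap.rTensor_comp_apply]

variable (k m) in
/-- `Hom((ℂ^k)^{⊗ s}, ℂ^m)`. -/
abbrev HomSpace (s : ℕ) : Type := (⨂[ℂ] _ : Fin s, (Fin k → ℂ)) →ₗ[ℂ] (Fin m → ℂ)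

/-- The linear form `h ↦ h(e_{i_1} ⊗ ⋯ ⊗ e_{i_s})_j` on `Hom((ℂ^k)^{⊗ s}, ℂ^m)`. -/
def entry {s : ℕ} (I : Fin s → Fin k) (j : Fin m) : HomSpace k m s →ₗ[ℂ] ℂ :=
  LinearMap.proj j ∘ₗ
    LinearMap.applyₗ (PiTensorProduct.tprod ℂ fun t => (Pi.single (I t) 1 : Fin k → ℂ))

/-- The linear coordinate on `A ⊗ Hom((ℂ^k)^{⊗ s}, ℂ^m)` induced by the form `entry I j`. -/
def entryOver {A : Alg} {s : ℕ} (I : Fin s → Fin k) (j : Fin m)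
    (h : A ⊗[ℂ] HomSpace k m s) : A :=
  TensorProduct.rid ℂ A (LinearMap.lTensor A (entry I j) h)

/-- The value of the coordinate `c` at a point of `U^r`, in a chart `Φ`. -/
def coord {r : ℕ} (Φ : U k m r ≅ affineSpace (Coord k m r)) {A : Alg} (p : (U k m r).obj A)
    (c : Coord k m r) : A :=
  (Φ.hom.app A p).down c

end DataScheme

end

open DataScheme CategoryTheory

/-!
The schemes `U^r` are described by charts: a chart of a subfunctor `V` of `X` is a natural
bijection `pt` of `A^ι` with the `A`-valued points of `V` (`Chart`). As `U^r` is open, a tangent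
vector at a point of `U^r` is a point of `U^r` with values in `A[ε]`, and so has coordinates
`a + ε w`, where `a` are the coordinates of the point and `w` those of the vector
(`Chart.exists_tang`).

Suppose that `U^r` has the coordinates `x_i`, `y^j_I` with `I` of length at most `r`, and that the
Semple bundle is given on it by `dy^j_I = ∑ i, y^j_{I, i} dx_i` for the `I` of length less than
`r`. The elements of the Semple bundle that are vertical, that is, tangent to `Y` if `r = 0` and
killed by the differential of `b_r` if `r ≥ 1`, are then those with `dx_1 = ⋯ = dx_k = 0`. Hence a
`k`-plane `W` in the Semple bundle avoids `C^{r+1}` exactly when the `dx_i` are independent on `W`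
at every point with values in a field. In a local frame of `W` the matrix of the `dx_i` is then
invertible, so that `W` is locally a graph `dc = ∑ i, N_{c, i} dx_i`, where `c` runs over the
coordinates of `U^r` (`Chart.exists_graph_of_frame`). The slopes `N_{c, i}` are determined by `W`
and therefore glue to global functions (`Chart.exists_graph`). Since `W` lies in the Semple
bundle, `N_{c, i}` is the coordinate `y^j_{I, i}` if `c = y^j_I` with `I` of length less than `r`,
whereas for `I` of length `r` it is arbitrary; these free slopes are the new coordinates
`y^j_{I, i}` of `U^{r+1}` (`StageChart.mem_iff_exists_nextPt`), and the description of the Semple bundle of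
`U^{r+1}` is that of the plane `W` (`StageChart.next`).

For `r = 0`, a family of lines that nowhere lies in `X_0 = 0` contains a vector `(1, z)`, because
the values of `X_0` on it form the unit ideal, and is spanned by it, because the quotients of
`A^{n+1}` by the two submodules are projective of the same rank (`exists_affinePt_iff`,
`grassmannian_eq_of_le`).
-/
noncomputable section

namespace DataScheme

open TensorProduct TrivSqZeroExt

/-! ### Dual numbers -/

section DualNumbers

variable {A B : Alg}

theorem dualFst_apply (z : DualNumber A) : (dualFst A).hom z = z.fst := rfl

theorem dualInl_apply (a : A) : (dualInl A).hom a = (inl a : DualNumber A) := rfl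

theorem dualMap_apply (φ : A ⟶ B) (z : DualNumber A) :
    (dualMap φ).hom z = (inl (φ.hom z.fst) + inr (φ.hom z.snd) : DualNumber B) := rfl

theorem comb_multiMap_apply {k : ℕ} (φ : A ⟶ B) (t : Fin k → B)
    (z : TrivSqZeroExt A (Fin k → A)) :
    (comb t).hom ((multiMap k φ).hom z) =
      (inl (φ.hom z.fst) + inr (∑ i, φ.hom (z.snd i) * t i) : DualNumber B) := by
  change (inl (inl (φ.hom z.fst) + inr (fun i => φ.hom (z.snd i)) :
      TrivSqZeroExt B (Fin k → B)).fst +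
    inr (∑ i, t i * (inl (φ.hom z.fst) + inr (fun i => φ.hom (z.snd i)) :
      TrivSqZeroExt B (Fin k → B)).snd i) : DualNumber B) = _
  ext
  · simp
  · simp [mul_comm]

end DualNumbers

/-! ### Gluing along a Zariski covering -/

section Gluing

variable {A : Alg}

theorem span_eq_top_of_forall_exists_notMem {R : Type*} [CommRing R] {S : Set R}
    (hS : ∀ P : PrimeSpectrum R, ∃ f ∈ S, f ∉ P.asIdeal) : Ideal.span S = ⊤ := by
  by_contra h
  obtain ⟨M, hM, hle⟩ := Ideal.exists_le_maximal _ h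
  obtain ⟨f, hf, hfM⟩ := hS ⟨M, hM.isPrime⟩
  exact hfM (hle (Ideal.subset_span hf))

theorem eq_of_loc_eq {S : Set A} (hS : Ideal.span S = ⊤) {x y : A}
    (h : ∀ f ∈ S, (loc A f).hom x = (loc A f).hom y) : x = y :=
  Localization.algebraMap_injective_of_span_eq_top S hS (funext fun f => h f.1 f.2)

/-- The map `A_f → A_{fg}`. -/
def locRight (f g : A) : CommAlgCat.of ℂ (Localization.Away f) ⟶
    CommAlgCat.of ℂ (Localization.Away (f * g)) :=
  CommAlgCat.ofHom
    { IsLocalization.Away.awayToAwayRight (S := Localization.Away f)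
        (P := Localization.Away (f * g)) f g with
      commutes' := fun c => by
        rw [IsScalarTower.algebraMap_apply ℂ A (Localization.Away f),
          IsScalarTower.algebraMap_apply ℂ A (Localization.Away (f * g))]
        exact IsLocalization.Away.awayToAwayRight_eq _ _ _ }

/-- The map `A_g → A_{fg}`. -/
def locLeft (f g : A) : CommAlgCat.of ℂ (Localization.Away g) ⟶
    CommAlgCat.of ℂ (Localization.Away (f * g)) :=
  CommAlgCat.ofHom
    { IsLocalization.Away.awayToAwayLeft (S := Localization.Away g)
        (P := Localization.Away (f * g)) g f with
      commutes' := fun c => by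
        rw [IsScalarTower.algebraMap_apply ℂ A (Localization.Away g),
          IsScalarTower.algebraMap_apply ℂ A (Localization.Away (f * g))]
        exact IsLocalization.Away.awayToAwayLeft_eq _ _ _ }

theorem loc_locRight (f g : A) : loc A f ≫ locRight f g = loc A g ≫ locLeft f g := by
  apply CommAlgCat.hom_ext
  apply AlgHom.ext
  intro a
  have h₁ := IsLocalization.Away.awayToAwayRight_eq (S := Localization.Away f)
    (P := Localization.Away (f * g)) f g a
  have h₂ := IsLocalization.Away.awayToAwayLeft_eq (S := Localization.Away g)
    (P := Localization.Away (f * g)) g f a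
  exact h₁.trans h₂.symm

/-- Elements of the localisations `A_f` of a Zariski covering glue as soon as they have the
same images in every algebra over two of these localisations. -/
theorem exists_loc_eq {S : Set A} (hS : Ideal.span S = ⊤) (s : ∀ f : S, Localization.Away f.1)
    (hs : ∀ (f g : S) (B : Alg) (ψ : CommAlgCat.of ℂ (Localization.Away f.1) ⟶ B)
      (χ : CommAlgCat.of ℂ (Localization.Away g.1) ⟶ B),
      loc A f.1 ≫ ψ = loc A g.1 ≫ χ → ψ.hom (s f) = χ.hom (s g)) :
    ∃ a : A, ∀ f : S, (loc A f.1).hom a = s f := by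
  obtain ⟨a, ha, -⟩ := Localization.existsUnique_algebraMap_eq_of_span_eq_top S hS s
    fun f g => hs f g _ (locRight f.1 g.1) (locLeft f.1 g.1) (loc_locRight f.1 g.1)
  exact ⟨a, ha⟩

theorem isUnit_of_field_ne_zero (a : A)
    (h : ∀ (K : Alg) (φ : A ⟶ K), IsField K → φ.hom a ≠ 0) : IsUnit a := by
  by_contra ha
  obtain ⟨M, hM, haM⟩ := exists_max_ideal_of_mem_nonunits ha
  refine h (CommAlgCat.of ℂ (A ⧸ M)) (CommAlgCat.ofHom (Ideal.Quotient.mkₐ ℂ M))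
    ((Ideal.Quotient.maximal_ideal_iff_isField_quotient M).mp hM) ?_
  exact Ideal.Quotient.eq_zero_iff_mem.mpr haM

end Gluing

/-! ### Charts and tangent vectors -/

/-- An isomorphism of the affine space `A ↦ A^ι` with the subfunctor `V` of `X`, presented by the
point `pt a` with coordinates `a`. The field `mem_of_comp_eq` says that a point `v` with values in
`A'` lies in `V` when its image under some `π : A' → A` does and every map from `A'` to a field
factors through `π`; this is the form in which it is used that an open set contains the
infinitesimal thickenings of its points. -/
structure Chart {X : Space} (V : Subfunctor X) (ι : Type) where
  pt : ∀ {A : Alg}, (ι → A) → X.obj A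
  map_pt : ∀ {A B : Alg} (φ : A ⟶ B) (a : ι → A), X.map φ (pt a) = pt (fun c => φ.hom (a c))
  mem_iff : ∀ {A : Alg} (p : X.obj A), p ∈ V.obj A ↔ ∃ a : ι → A, pt a = p
  injective : ∀ {A : Alg}, Function.Injective (pt : (ι → A) → X.obj A)
  mem_of_comp_eq : ∀ {A A' : Alg} (π : A' ⟶ A) (σ : A ⟶ A'),
    (∀ (K : Alg) (φ : A' ⟶ K), IsField K → φ = π ≫ σ ≫ φ) →
    ∀ v : X.obj A', X.map π v ∈ V.obj A → v ∈ V.obj A'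

/-- A map from an algebra `A ⊕ M` with `M² = 0` to a field kills `M`. -/
theorem map_eq_map_inl_fst {A : Type*} [CommRing A] {M : Type*} [AddCommGroup M] [Module A M]
    [Module Aᵐᵒᵖ M] [IsCentralScalar A M] {K : Type*} [CommRing K] (hK : IsField K)
    (φ : TrivSqZeroExt A M →+* K) (z : TrivSqZeroExt A M) : φ z = φ (inl z.fst) := by
  have h : φ (inr z.snd) * φ (inr z.snd) = 0 := by rw [← map_mul, inr_mul_inr, map_zero]
  have : IsDomain K := hK.isDomain
  conv_lhs => rw [← inl_fst_add_inr_snd_eq z, map_add, mul_self_eq_zero.mp h, add_zero]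

/-- The inclusion of constants `A → A[ε₁, …, ε_k]`. -/
def multiInl (k : ℕ) (A : Alg) : A ⟶ multiDual k A :=
  CommAlgCat.ofHom (TrivSqZeroExt.inlAlgHom ℂ A (Fin k → A))

theorem dual_comp_eq (A K : Alg) (φ : dual A ⟶ K) (hK : IsField K) :
    φ = dualFst A ≫ dualInl A ≫ φ := by
  apply CommAlgCat.hom_ext
  apply AlgHom.ext
  exact map_eq_map_inl_fst hK φ.hom.toRingHom

theorem multiDual_comp_eq (k : ℕ) (A K : Alg) (φ : multiDual k A ⟶ K) (hK : IsField K) :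
    φ = multiFst k A ≫ multiInl k A ≫ φ := by
  apply CommAlgCat.hom_ext
  apply AlgHom.ext
  exact map_eq_map_inl_fst hK φ.hom.toRingHom

namespace Chart

variable {X : Space} {V : Subfunctor X} {ι : Type} (χ : Chart V ι) {A B : Alg}

theorem pt_mem (a : ι → A) : χ.pt a ∈ V.obj A := (χ.mem_iff _).mpr ⟨a, rfl⟩

/-- The tangent vector at the point with coordinates `a` along which the coordinates have the
derivatives `w`. -/
def tang (a w : ι → A) : X.obj (dual A) :=
  χ.pt (A := dual A) fun c => (inl (a c) + inr (w c) : DualNumber A)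

theorem pt_dual (z : ι → DualNumber A) :
    χ.pt (A := dual A) z = χ.tang (fun c => (z c).fst) fun c => (z c).snd := by
  unfold tang
  congr 1
  funext c
  exact (inl_fst_add_inr_snd_eq _).symm

theorem tang_inj {a a' w w' : ι → A} : χ.tang a w = χ.tang a' w' ↔ a = a' ∧ w = w' := by
  refine ⟨fun h => ?_, by rintro ⟨rfl, rfl⟩; rfl⟩
  have h := χ.injective h
  refine ⟨funext fun c => ?_, funext fun c => ?_⟩
  · simpa using congrArg TrivSqZeroExt.fst (congrFun h c)
  · simpa using congrArg TrivSqZeroExt.snd (congrFun h c)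

theorem map_dualFst_tang (a w : ι → A) : X.map (dualFst A) (χ.tang a w) = χ.pt a := by
  rw [tang, χ.map_pt]
  congr 1
  funext c
  rw [dualFst_apply]
  simp

theorem map_dualMap_tang (φ : A ⟶ B) (a w : ι → A) :
    X.map (dualMap φ) (χ.tang a w) =
      χ.tang (fun c => φ.hom (a c)) (fun c => φ.hom (w c)) := by
  rw [tang, χ.map_pt]
  unfold tang
  congr 1
  funext c
  rw [dualMap_apply]
  simp

theorem exists_tang {v : X.obj (dual A)} {a : ι → A} (hv : X.map (dualFst A) v = χ.pt a) :
    ∃ w, v = χ.tang a w := by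
  obtain ⟨z, rfl⟩ := (χ.mem_iff v).mp (χ.mem_of_comp_eq (dualFst A) (dualInl A)
    (fun K φ hK => dual_comp_eq A K φ hK) v (hv ▸ χ.pt_mem a))
  have h := χ.injective ((χ.map_pt _ _).symm.trans hv)
  refine ⟨fun c => TrivSqZeroExt.snd (z c), ?_⟩
  rw [pt_dual, ← h]
  rfl

theorem tang_mem (a w : ι → A) : χ.tang a w ∈ V.obj (dual A) := χ.pt_mem _

theorem isZeroVector_tang {a w : ι → A} : IsZeroVector (χ.tang a w) ↔ w = 0 := by
  have : X.map (dualFst A ≫ dualInl A) (χ.tang a w) = χ.tang a 0 := by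
    rw [Functor.map_comp_apply, map_dualFst_tang, χ.map_pt]
    unfold tang
    congr 1
    funext c
    rw [dualInl_apply]
    simp
  rw [IsZeroVector, this, tang_inj]
  exact ⟨fun h => h.2.symm, fun h => ⟨rfl, h.symm⟩⟩

/-- The frame of tangent vectors at the point `a` with the derivatives `T · i`, `i = 1, …, k`. -/
def frame {k : ℕ} (a : ι → A) (T : ι → Fin k → A) : X.obj (multiDual k A) :=
  χ.pt (A := multiDual k A) fun c => (inl (a c) + inr (T c) : TrivSqZeroExt A (Fin k → A))

theorem exists_frame {k : ℕ} {e : X.obj (multiDual k A)} {a : ι → A}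
    (he : X.map (multiFst k A) e = χ.pt a) : ∃ T, e = χ.frame a T := by
  obtain ⟨z, rfl⟩ := (χ.mem_iff e).mp (χ.mem_of_comp_eq (multiFst k A) (multiInl k A)
    (fun K φ hK => multiDual_comp_eq k A K φ hK) e (he ▸ χ.pt_mem a))
  have h := χ.injective ((χ.map_pt _ _).symm.trans he)
  refine ⟨fun c => TrivSqZeroExt.snd (z c), ?_⟩
  unfold frame
  congr 1
  rw [← h]
  funext c
  exact (inl_fst_add_inr_snd_eq _).symm

theorem map_multiFst_frame {k : ℕ} (a : ι → A) (T : ι → Fin k → A) :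
    X.map (multiFst k A) (χ.frame a T) = χ.pt a := by
  rw [frame, χ.map_pt]
  congr 1
  funext c
  change TrivSqZeroExt.fst (inl (a c) + inr (T c) : TrivSqZeroExt A (Fin k → A)) = a c
  simp

theorem map_comb_frame {k : ℕ} (φ : A ⟶ B) (a : ι → A) (T : ι → Fin k → A) (t : Fin k → B) :
    X.map (comb t) (X.map (multiMap k φ) (χ.frame a T)) =
      χ.tang (fun c => φ.hom (a c)) (fun c => ∑ i, φ.hom (T c i) * t i) := by
  rw [frame, χ.map_pt, χ.map_pt]
  unfold tang
  congr 1
  funext c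
  rw [comb_multiMap_apply]
  simp

end Chart

/-! ### Planes of tangent vectors as graphs -/

namespace Chart

variable {X : Stage} {V : Subfunctor X.space} {ι : Type} (χ : Chart V ι) {k : ℕ} (x : Fin k → ι)
  {A B : Alg}

/-- The tangent vectors with values in `B` at the point `a` that satisfy the equations
`dc = ∑ i, N c i * dx_i`, parametrised by the values `t_i` of `dx_i`. -/
def graph (a : ι → A) (N : ι → Fin k → A) (φ : A ⟶ B) : Set (X.space.obj (dual B)) :=
  Set.range fun t : Fin k → B =>
    χ.tang (fun c => φ.hom (a c)) (fun c => ∑ i, φ.hom (N c i) * t i)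

/-- The slopes `N` have the tautological values at the coordinates `x_i`: `dx_i = dx_i`. -/
def IsSlope (N : ι → Fin k → A) : Prop := ∀ i, N (x i) = Pi.single i 1

variable {χ x}

theorem IsSlope.sum_eq {N : ι → Fin k → A} (hN : IsSlope x N) (φ : A ⟶ B) (t : Fin k → B)
    (i : Fin k) : ∑ j, φ.hom (N (x i) j) * t j = t i := by
  rw [hN i, Finset.sum_eq_single i]
  · simp
  · intro j _ hj
    simp [hj]
  · simp

theorem IsSlope.map {N : ι → Fin k → A} (hN : IsSlope x N) (φ : A ⟶ B) :
    IsSlope x fun c i => φ.hom (N c i) := by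
  intro i
  funext j
  change φ.hom (N (x i) j) = _
  rw [hN i, Pi.single_apply, Pi.single_apply]
  split_ifs <;> simp

theorem tang_mem_graph {a : ι → A} {N : ι → Fin k → A} (hN : IsSlope x N) {φ : A ⟶ B}
    {a' w : ι → B} : χ.tang a' w ∈ χ.graph a N φ ↔
      a' = (fun c => φ.hom (a c)) ∧ ∀ c, w c = ∑ i, φ.hom (N c i) * w (x i) := by
  constructor
  · rintro ⟨t, ht⟩
    obtain ⟨rfl, rfl⟩ := χ.tang_inj.mp ht
    refine ⟨rfl, fun c => ?_⟩
    simp only [hN.sum_eq]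
  · rintro ⟨rfl, h⟩
    exact ⟨fun i => w (x i), χ.tang_inj.mpr ⟨rfl, funext fun c => (h c).symm⟩⟩

/-- The slopes are determined by the plane: `N c i` is the value of `dc` on the vector of the plane
with `dx_i = 1` and `dx_j = 0` for `j ≠ i`. -/
theorem graph_inj {a : ι → A} {N N' : ι → Fin k → A} (hN : IsSlope x N) (hN' : IsSlope x N')
    {φ : A ⟶ B} (h : χ.graph a N φ = χ.graph a N' φ) (c : ι) (i : Fin k) :
    φ.hom (N c i) = φ.hom (N' c i) := by
  have hi : ∀ (M : ι → Fin k → A) (c : ι),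
      ∑ j, φ.hom (M c j) * (Pi.single i 1 : Fin k → B) j = φ.hom (M c i) := by
    intro M c
    rw [Finset.sum_eq_single i] <;> simp +contextual
  have hmem : χ.tang (fun c => φ.hom (a c)) (fun c => φ.hom (N c i)) ∈ χ.graph a N φ :=
    ⟨Pi.single i 1, χ.tang_inj.mpr ⟨rfl, funext (hi N)⟩⟩
  rw [h, tang_mem_graph hN'] at hmem
  refine (hmem.2 c).trans ?_
  rw [← hi N' c]
  refine Finset.sum_congr rfl fun j _ => ?_
  rw [hN j, Pi.single_apply, Pi.single_apply]
  by_cases hij : i = j <;> simp [hij, eq_comm]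

theorem graph_pull {a : ι → A} {N : ι → Fin k → A} {C : Alg} (φ : A ⟶ B) (ψ : B ⟶ C) :
    χ.graph (fun c => φ.hom (a c)) (fun c i => φ.hom (N c i)) ψ = χ.graph a N (φ ≫ ψ) := rfl

/-- A plane with a frame is a graph over the coordinates `x_i` when at no point with values in a
field it contains a nonzero vector along which all `x_i` are constant: the matrix of the `dx_i` in
the frame is then invertible. -/
theorem exists_graph_of_frame {a : ι → A} {T : ι → Fin k → A}
    (hinj : ∀ (B : Alg) (φ : A ⟶ B), Function.Injective fun t : Fin k → B =>
      χ.tang (fun c => φ.hom (a c)) (fun c => ∑ i, φ.hom (T c i) * t i))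
    (htr : ∀ (K : Alg) (φ : A ⟶ K), IsField K → ∀ t : Fin k → K,
      (∀ i, ∑ j, φ.hom (T (x i) j) * t j = 0) → ∀ c, ∑ j, φ.hom (T c j) * t j = 0) :
    ∃ N : ι → Fin k → A, IsSlope x N ∧ ∀ (B : Alg) (φ : A ⟶ B),
      χ.graph a N φ = χ.graph a T φ := by
  -- the matrix of the `dx_i` in the frame; the slopes are `T * M⁻¹`
  let M : Matrix (Fin k) (Fin k) A := Matrix.of fun i j => T (x i) j
  have hdet : IsUnit M.det := by
    refine isUnit_of_field_ne_zero _ fun K φ hK h0 => ?_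
    let _ := hK.toField
    have h0' : (M.map φ.hom).det = 0 := by
      rw [← h0]
      exact (RingHom.map_det φ.hom.toRingHom M).symm
    obtain ⟨t, ht, h⟩ := Matrix.exists_mulVec_eq_zero_iff.mpr h0'
    refine ht (hinj K φ ?_)
    refine χ.tang_inj.mpr ⟨rfl, funext fun c => ?_⟩
    refine (htr K φ hK t (fun i => congrFun h i) c).trans ?_
    simp
  have h1 : M * M⁻¹ = 1 := Matrix.mul_nonsing_inv _ hdet
  have h2 : M⁻¹ * M = 1 := Matrix.nonsing_inv_mul _ hdet
  let TT : Matrix ι (Fin k) A := Matrix.of T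
  refine ⟨TT * M⁻¹, fun i => ?_, fun B φ => ?_⟩
  · have : (TT * M⁻¹) (x i) = (M * M⁻¹) i := by
      funext j
      simp [Matrix.mul_apply, M, TT]
    rw [this, h1]
    funext j
    simp [Matrix.one_apply, Pi.single_apply, eq_comm]
  · have hmv : ∀ (L : Matrix ι (Fin k) A) (t : Fin k → B),
        (fun c => ∑ i, φ.hom (L c i) * t i) = (L.map φ.hom).mulVec t := fun L t => rfl
    have hmul : (TT * M⁻¹).map φ.hom = TT.map φ.hom * M⁻¹.map φ.hom :=
      Matrix.map_mul (f := φ.hom.toRingHom)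
    have h2' : M⁻¹.map φ.hom * M.map φ.hom = 1 := by
      refine (Matrix.map_mul (f := φ.hom.toRingHom)).symm.trans ?_
      rw [h2]
      exact Matrix.map_one _ (map_zero φ.hom) (map_one φ.hom)
    ext v
    constructor
    · rintro ⟨t, rfl⟩
      refine ⟨(M⁻¹.map φ.hom).mulVec t, χ.tang_inj.mpr ⟨rfl, ?_⟩⟩
      rw [hmv (TT * M⁻¹), hmul, ← Matrix.mulVec_mulVec]
      rfl
    · rintro ⟨t, rfl⟩
      refine ⟨(M.map φ.hom).mulVec t, χ.tang_inj.mpr ⟨rfl, ?_⟩⟩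
      rw [hmv (TT * M⁻¹), hmul, Matrix.mulVec_mulVec, Matrix.mul_assoc, h2', Matrix.mul_one]
      rfl

/-- A point of the Grassmann bundle over the chart whose planes, at points with values in a field,
contain no nonzero vector along which all `x_i` are constant is the family of planes with the
equations `dc = ∑ i, N c i * dx_i`. The slopes `N` exist locally, and glue because they are
determined by the plane. -/
theorem exists_graph (p : GrPoint X k A) {a : ι → A} (ha : p.base = χ.pt a)
    (htr : ∀ (K : Alg) (φ : A ⟶ K), IsField K → ∀ w : ι → K,
      χ.tang (fun c => φ.hom (a c)) w ∈ p.carrier K φ → (∀ i, w (x i) = 0) → w = 0) :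
    ∃ N : ι → Fin k → A, IsSlope x N ∧
      ∀ (B : Alg) (φ : A ⟶ B), p.carrier B φ = χ.graph a N φ := by
  -- the open sets `D(f)` over which the plane is a graph
  let S : Set A := {f | ∃ N : ι → Fin k → Localization.Away f,
    IsSlope (A := CommAlgCat.of ℂ (Localization.Away f)) x N ∧
    ∀ (B : Alg) (ψ : CommAlgCat.of ℂ (Localization.Away f) ⟶ B),
      p.carrier B (loc A f ≫ ψ) = χ.graph (fun c => (loc A f).hom (a c)) N ψ}
  have hS' : ∀ P : PrimeSpectrum A, ∃ f ∈ S, f ∉ P.asIdeal := by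
    intro P
    obtain ⟨f, hf, e, he, hb⟩ := p.exists_frame P
    refine ⟨f, ?_, hf⟩
    rw [ha, χ.map_pt] at he
    obtain ⟨T, rfl⟩ := χ.exists_frame he
    have hb' : ∀ (B : Alg) (ψ : CommAlgCat.of ℂ (Localization.Away f) ⟶ B), Set.BijOn
        (fun t : Fin k → B => χ.tang (fun c => ψ.hom ((loc A f).hom (a c)))
          (fun c => ∑ i, ψ.hom (T c i) * t i)) Set.univ (p.carrier B (loc A f ≫ ψ)) := by
      intro B ψ
      simpa only [χ.map_comb_frame] using hb B ψ
    obtain ⟨N, hN, hgr⟩ := exists_graph_of_frame (χ := χ) (x := x)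
      (A := CommAlgCat.of ℂ (Localization.Away f)) (a := fun c => (loc A f).hom (a c)) (T := T)
      (fun B ψ => Set.injOn_univ.mp (hb' B ψ).injOn)
      (fun K ψ hK t ht => congrFun (htr K (loc A f ≫ ψ) hK _
        ((hb' K ψ).mapsTo (Set.mem_univ t)) ht))
    refine ⟨N, hN, fun B ψ => ?_⟩
    rw [hgr, ← (hb' B ψ).image_eq, Set.image_univ]
    rfl
  have hS := span_eq_top_of_forall_exists_notMem hS'
  have hloc : ∀ f : S, ∃ N : ι → Fin k → Localization.Away f.1,
    IsSlope (A := CommAlgCat.of ℂ (Localization.Away f.1)) x N ∧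
    ∀ (B : Alg) (ψ : CommAlgCat.of ℂ (Localization.Away f.1) ⟶ B),
      p.carrier B (loc A f.1 ≫ ψ) = χ.graph (fun c => (loc A f.1).hom (a c)) N ψ := fun f => f.2
  choose N hN hgr using hloc
  have hglue : ∀ c i, ∃ n : A, ∀ f : S, (loc A f.1).hom n = N f c i := by
    intro c i
    refine exists_loc_eq hS (fun f => N f c i) fun f g B ψ ω h => ?_
    have hf := hgr f B ψ
    have hg := hgr g B ω
    rw [← h, hf] at hg
    have hac : ∀ c, ψ.hom ((loc A f.1).hom (a c)) = ω.hom ((loc A g.1).hom (a c)) := fun c =>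
      congrArg (fun φ : A ⟶ B => φ.hom (a c)) h
    refine graph_inj (χ := χ) (a := fun c => ψ.hom ((loc A f.1).hom (a c))) (φ := 𝟙 B)
      ((hN f).map ψ) ((hN g).map ω) ?_ c i
    refine hg.trans ?_
    simp only [hac]
    rfl
  choose n hn using hglue
  have hnN : ∀ f : S, (fun c i => (loc A f.1).hom (n c i)) = N f := fun f =>
    funext fun c => funext fun i => hn c i f
  have hslope : IsSlope x n := by
    intro i
    funext j
    refine eq_of_loc_eq hS fun f hf => ?_
    rw [hn (x i) j ⟨f, hf⟩, hN ⟨f, hf⟩ i, Pi.single_apply, Pi.single_apply]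
    split_ifs <;> simp
  refine ⟨n, hslope, fun B φ => ?_⟩
  -- over `B_{φ f}` with `f ∈ S` the plane is the graph of `n`
  have hlocB : ∀ f : S, p.carrier _ (φ ≫ loc B (φ.hom f.1)) =
      χ.graph a n (φ ≫ loc B (φ.hom f.1)) := by
    intro f
    rw [← loc_locMap, hgr, ← hnN f, graph_pull]
  have hSB : Ideal.span (φ.hom '' S) = ⊤ := by
    have h := congrArg (Ideal.map φ.hom.toRingHom) hS
    rw [Ideal.map_top, Ideal.map_span] at h
    exact h
  -- both membership conditions can be checked on the `B_{φ f}`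
  ext v
  have htang : X.space.map (dualFst B) v = X.space.map φ p.base →
      ∃ w, v = χ.tang (fun c => φ.hom (a c)) w := by
    intro h
    rw [ha, χ.map_pt] at h
    exact χ.exists_tang h
  constructor
  · intro hv
    obtain ⟨w, rfl⟩ := htang (p.tangent B φ v hv)
    refine (tang_mem_graph hslope).mpr ⟨rfl, fun c => eq_of_loc_eq hSB ?_⟩
    rintro _ ⟨f, hf, rfl⟩
    have h := p.map_mem B _ φ (loc B (φ.hom f)) _ hv
    rw [hlocB ⟨f, hf⟩, χ.map_dualMap_tang, tang_mem_graph hslope] at h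
    rw [h.2 c, map_sum]
    simp
  · intro hv
    have hbase : X.space.map (dualFst B) v = X.space.map φ p.base := by
      obtain ⟨t, rfl⟩ := hv
      rw [χ.map_dualFst_tang, ha, χ.map_pt]
    refine p.of_local B φ v hbase fun P => ?_
    obtain ⟨f, hf, hfP⟩ := hS' (PrimeSpectrum.comap φ.hom.toRingHom P)
    refine ⟨φ.hom f, hfP, ?_⟩
    rw [hlocB ⟨f, hf⟩]
    obtain ⟨t, rfl⟩ := hv
    refine ⟨fun i => (loc B (φ.hom f)).hom (t i), ?_⟩
    rw [χ.map_dualMap_tang]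
    refine χ.tang_inj.mpr ⟨rfl, funext fun c => ?_⟩
    rw [map_sum]
    simp

/-- The point of the Grassmann bundle given by the planes with the equations
`dc = ∑ i, N c i * dx_i`. -/
def graphPoint (χ : Chart V ι) (x : Fin k → ι) (a : ι → A) (N : ι → Fin k → A)
    (hN : IsSlope x N) (hF : ∀ (B : Alg) (φ : A ⟶ B), χ.graph a N φ ⊆ X.focal B) :
    GrPoint X k A where
  base := χ.pt a
  carrier B φ := χ.graph a N φ
  tangent := by
    rintro B φ _ ⟨t, rfl⟩
    rw [χ.map_dualFst_tang, χ.map_pt]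
  le_focal := hF
  map_mem := by
    rintro B C φ ψ _ ⟨t, rfl⟩
    refine ⟨fun i => ψ.hom (t i), ?_⟩
    rw [χ.map_dualMap_tang]
    refine χ.tang_inj.mpr ⟨rfl, funext fun c => ?_⟩
    rw [map_sum]
    simp
  of_local := by
    intro B φ v hv h
    rw [χ.map_pt] at hv
    obtain ⟨w, rfl⟩ := χ.exists_tang hv
    choose f hf hfv using h
    refine (tang_mem_graph hN).mpr ⟨rfl, fun c => ?_⟩
    refine eq_of_loc_eq (S := Set.range f)
      (span_eq_top_of_forall_exists_notMem fun P => ⟨f P, ⟨P, rfl⟩, hf P⟩) ?_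
    rintro _ ⟨P, rfl⟩
    have h := hfv P
    rw [χ.map_dualMap_tang, tang_mem_graph hN] at h
    rw [h.2 c, map_sum]
    simp
  exists_frame := by
    -- the columns of `N` are a global frame
    intro P
    refine ⟨1, fun h => P.isPrime.ne_top ((Ideal.eq_top_iff_one _).mpr h), ?_⟩
    refine ⟨χ.frame (fun c => (loc A 1).hom (a c)) (fun c i => (loc A 1).hom (N c i)), ?_, ?_⟩
    · rw [χ.map_multiFst_frame, χ.map_pt]
    · intro B ψ
      simp only [χ.map_comb_frame]
      refine ⟨fun t _ => ⟨t, rfl⟩, fun t _ t' _ h => ?_, ?_⟩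
      · funext i
        have h := congrFun (χ.tang_inj.mp h).2 (x i)
        exact (hN.sum_eq (loc A 1 ≫ ψ) t i).symm.trans (h.trans (hN.sum_eq (loc A 1 ≫ ψ) t' i))
      · rintro _ ⟨t, rfl⟩
        exact ⟨t, Set.mem_univ _, rfl⟩

end Chart

/-! ### The affine part of projective space -/

section Affine

variable {n : ℕ} {A B : Alg}

/-- The homogeneous coordinates `A ⊗ ℂⁿ⁺¹ ≃ Aⁿ⁺¹`. -/
def homog (n : ℕ) (A : Alg) : (A ⊗[ℂ] (Fin (n + 1) → ℂ)) ≃ₗ[A] (Fin (n + 1) → A) :=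
  TensorProduct.piScalarRight ℂ A A (Fin (n + 1))

theorem homog_tmul (a : A) (v : Fin (n + 1) → ℂ) (i : Fin (n + 1)) :
    homog n A (a ⊗ₜ v) i = v i • a := rfl

theorem X0_eq (u : A ⊗[ℂ] (Fin (n + 1) → ℂ)) : X0 n A u = homog n A u 0 := by
  induction u with
  | zero => simp
  | tmul a v =>
    rw [homog_tmul]
    simp [X0]
  | add u v hu hv => simp [hu, hv]

/-- The vector `(1, z_1, …, z_n)`. -/
def affineVec (z : Fin n → A) : A ⊗[ℂ] (Fin (n + 1) → ℂ) :=
  ∑ i : Fin (n + 1), (Fin.cons (1 : A) z : Fin (n + 1) → A) i ⊗ₜ[ℂ]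
    (Pi.single i 1 : Fin (n + 1) → ℂ)

theorem homog_affineVec (z : Fin n → A) : homog n A (affineVec z) = Fin.cons 1 z := by
  funext i
  rw [affineVec, map_sum, Finset.sum_apply, Finset.sum_eq_single i]
  · rw [homog_tmul]
    simp
  · intro j _ hj
    rw [homog_tmul]
    simp [hj.symm]
  · simp

/-- The linear map `Aⁿ⁺¹ → Aⁿ`, `u ↦ (u_i - u_0 z_i)`, whose kernel is spanned by
`(1, z_1, …, z_n)`. -/
def affineQuot (z : Fin n → A) : (A ⊗[ℂ] (Fin (n + 1) → ℂ)) →ₗ[A] (Fin n → A) :=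
  (LinearMap.pi fun i => LinearMap.proj i.succ - (z i) • LinearMap.proj 0) ∘ₗ
    (homog n A).toLinearMap

theorem affineQuot_apply (z : Fin n → A) (u : A ⊗[ℂ] (Fin (n + 1) → ℂ)) (i : Fin n) :
    affineQuot z u i = homog n A u i.succ - z i * homog n A u 0 := rfl

theorem affineQuot_surjective (z : Fin n → A) : Function.Surjective (affineQuot z) := by
  intro w
  refine ⟨(homog n A).symm (Fin.cons 0 w), ?_⟩
  funext i
  rw [affineQuot_apply]
  simp

theorem ker_affineQuot (z : Fin n → A) :
    LinearMap.ker (affineQuot z) = Submodule.span A {affineVec z} := by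
  ext u
  rw [LinearMap.mem_ker, Submodule.mem_span_singleton]
  constructor
  · intro h
    refine ⟨homog n A u 0, (homog n A).injective ?_⟩
    rw [map_smul, homog_affineVec]
    funext i
    refine Fin.cases ?_ (fun i => ?_) i
    · simp
    · have := congrFun h i
      rw [affineQuot_apply] at this
      simp only [Pi.smul_apply, Fin.cons_succ, smul_eq_mul]
      rw [mul_comm]
      exact (sub_eq_zero.mp this).symm
  · rintro ⟨c, rfl⟩
    funext i
    rw [affineQuot_apply, map_smul, homog_affineVec]
    simp [mul_comm]

theorem affineVec_mem_ker_iff {z z' : Fin n → A} :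
    affineVec z ∈ LinearMap.ker (affineQuot z') ↔ z = z' := by
  rw [LinearMap.mem_ker]
  constructor
  · intro h
    funext i
    have := congrFun h i
    rw [affineQuot_apply, homog_affineVec] at this
    simpa [sub_eq_zero] using this
  · rintro rfl
    funext i
    rw [affineQuot_apply, homog_affineVec]
    simp

theorem exists_eq_affineVec {u : A ⊗[ℂ] (Fin (n + 1) → ℂ)} (hu : homog n A u 0 = 1) :
    ∃ z : Fin n → A, u = affineVec z := by
  refine ⟨fun i => homog n A u i.succ, (homog n A).injective ?_⟩
  rw [homog_affineVec]
  funext i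
  refine Fin.cases ?_ (fun i => ?_) i
  · simpa using hu
  · simp

/-- The point `(1 : z_1 : … : z_n)` of projective space. -/
def affinePt (z : Fin n → A) : (proj n).obj A :=
  ULift.up
    { toSubmodule := LinearMap.ker (affineQuot z)
      finite_quotient := Module.Finite.equiv
        ((affineQuot z).quotKerEquivOfSurjective (affineQuot_surjective z)).symm
      projective_quotient := Module.Projective.of_equiv
        ((affineQuot z).quotKerEquivOfSurjective (affineQuot_surjective z)).symm
      rankAtStalk_eq := fun P => by
        have : Nontrivial A := ⟨0, 1, fun h => P.isPrime.ne_top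
          ((Ideal.eq_top_iff_one _).mpr (h ▸ P.asIdeal.zero_mem))⟩
        rw [Module.rankAtStalk_eq_of_equiv
          ((affineQuot z).quotKerEquivOfSurjective (affineQuot_surjective z)),
          Module.rankAtStalk_eq_finrank_of_free]
        simp }

theorem line_affinePt (z : Fin n → A) : line (affinePt z) = LinearMap.ker (affineQuot z) := rfl

theorem proj_ext {p q : (proj n).obj A} (h : line p = line q) : p = q :=
  ULift.ext _ _ (Module.Grassmannian.ext h)

/-- Of two points of a Grassmannian, none is contained in the other unless they are equal: the
surjection between the quotients, which are projective of the same rank, is bijective. -/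
theorem grassmannian_eq_of_le {R M : Type*} [CommRing R] [AddCommGroup M] [Module R M] {n : ℕ}
    {p q : Module.Grassmannian R M n} (h : p.toSubmodule ≤ q.toSubmodule) : p = q := by
  refine Module.Grassmannian.ext (le_antisymm h fun u hu => ?_)
  have hbij : Function.Bijective (Submodule.factor h) :=
    Module.bijective_of_surjective_of_rankAtStalk_eq (Submodule.factor_surjective h)
      fun _ _ => (p.rankAtStalk_eq _).trans (q.rankAtStalk_eq _).symm
  rw [← Submodule.Quotient.mk_eq_zero]
  refine hbij.1 ?_
  rw [map_zero]
  exact (Submodule.Quotient.mk_eq_zero _).mpr hu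

theorem proj_eq_of_le {p q : (proj n).obj A} (h : line p ≤ line q) : p = q :=
  ULift.ext _ _ (grassmannian_eq_of_le h)

theorem eq_affinePt {p : (proj n).obj A} {z : Fin n → A} (h : affineVec z ∈ line p) :
    p = affinePt z := by
  refine (proj_eq_of_le ?_).symm
  rw [line_affinePt, ker_affineQuot, Submodule.span_singleton_le_iff_mem]
  exact h

theorem affinePt_injective : Function.Injective (affinePt (n := n) (A := A)) := by
  intro z z' h
  rw [← affineVec_mem_ker_iff (z := z), ← line_affinePt, ← h, line_affinePt,
    affineVec_mem_ker_iff]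

/-- Base change of vectors along `φ : A → B`. -/
def mapVec (φ : A ⟶ B) :
    (A ⊗[ℂ] (Fin (n + 1) → ℂ)) →ₗ[ℂ] (B ⊗[ℂ] (Fin (n + 1) → ℂ)) :=
  LinearMap.rTensor _ φ.hom.toLinearMap

theorem homog_mapVec (φ : A ⟶ B) (u : A ⊗[ℂ] (Fin (n + 1) → ℂ)) (i : Fin (n + 1)) :
    homog n B (mapVec φ u) i = φ.hom (homog n A u i) := by
  induction u with
  | zero => simp
  | tmul a v =>
    rw [homog_tmul]
    change homog n B (φ.hom a ⊗ₜ v) i = _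
    rw [homog_tmul, map_smul]
  | add u v hu hv => simp [hu, hv]

theorem mapVec_affineVec (φ : A ⟶ B) (z : Fin n → A) :
    mapVec φ (affineVec z) = affineVec fun i => φ.hom (z i) := by
  apply (homog n B).injective
  funext i
  rw [homog_mapVec, homog_affineVec, homog_affineVec]
  refine Fin.cases ?_ (fun i => ?_) i <;> simp

/-- The base change of a line is spanned by the images of its elements. -/
theorem line_map (φ : A ⟶ B) (p : (proj n).obj A) :
    line ((proj n).map φ p) = Submodule.span B (mapVec φ '' line p) := by
  let _ : Algebra A B := φ.hom.toAlgebra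
  have : IsScalarTower ℂ A B :=
    IsScalarTower.of_algebraMap_eq' <| IsScalarTower.algebraMap_eq ℂ A B
  have hline : line ((proj n).map φ p) =
      LinearMap.ker (Module.Grassmannian.baseChangeMkQ B (line p)) := rfl
  let e := AlgebraTensorModule.cancelBaseChange ℂ A B B (Fin (n + 1) → ℂ)
  have he : ∀ u : A ⊗[ℂ] (Fin (n + 1) → ℂ), e (1 ⊗ₜ u) = mapVec φ u := by
    intro u
    induction u with
    | zero => simp
    | tmul a v =>
      change (a • (1 : B)) ⊗ₜ[ℂ] v = φ.hom a ⊗ₜ[ℂ] v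
      rw [Algebra.smul_def, mul_one]
      rfl
    | add u v hu hv => rw [tmul_add, map_add, map_add, hu, hv]
  rw [hline]
  have hex : Function.Exact ((line p).subtype.lTensor B) ((line p).mkQ.lTensor B) :=
    lTensor_exact B (LinearMap.exact_subtype_mkQ _) (Submodule.mkQ_surjective _)
  refine le_antisymm (fun w hw => ?_) (Submodule.span_le.mpr ?_)
  · obtain ⟨t, ht⟩ := (hex (e.symm w)).mp hw
    have hw' : w = e ((line p).subtype.lTensor B t) := by rw [ht, e.apply_symm_apply]
    rw [hw']
    clear hw hw' ht
    induction t with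
    | zero => simp
    | tmul b u =>
      have : (b ⊗ₜ[A] (u : A ⊗[ℂ] (Fin (n + 1) → ℂ))) = b • ((1 : B) ⊗ₜ[A] (u : A ⊗[ℂ] _)) := by
        rw [smul_tmul', smul_eq_mul, mul_one]
      rw [LinearMap.lTensor_tmul, Submodule.subtype_apply, this, map_smul, he]
      exact Submodule.smul_mem _ _ (Submodule.subset_span ⟨u, u.2, rfl⟩)
    | add s t hs ht =>
      rw [map_add, map_add]
      exact add_mem hs ht
  · rintro _ ⟨u, hu, rfl⟩
    rw [← he]
    change (line p).mkQ.lTensor B (e.symm (e _)) = 0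
    rw [e.symm_apply_apply, LinearMap.lTensor_tmul, Submodule.mkQ_apply,
      (Submodule.Quotient.mk_eq_zero _).mpr hu, tmul_zero]

theorem map_affinePt (φ : A ⟶ B) (z : Fin n → A) :
    (proj n).map φ (affinePt z) = affinePt fun i => φ.hom (z i) := by
  refine eq_affinePt ?_
  rw [line_map, ← mapVec_affineVec]
  refine Submodule.subset_span ⟨_, ?_, rfl⟩
  rw [line_affinePt]
  exact affineVec_mem_ker_iff.mpr rfl

/-- A family of lines none of which lies in the hyperplane `X_0 = 0` consists of points
`(1 : z_1 : … : z_n)`: the values of `X_0` on the family form the unit ideal, so that it contains a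
vector with `X_0 = 1`. -/
theorem exists_affinePt_iff (p : (proj n).obj A) :
    (∃ z : Fin n → A, affinePt z = p) ↔ ∀ (K : Alg) (φ : A ⟶ K), IsField K →
      ¬ ∀ v ∈ line ((proj n).map φ p), X0 n K v = 0 := by
  constructor
  · rintro ⟨z, rfl⟩ K φ hK h
    have h := h (affineVec fun i => φ.hom (z i)) (by
      rw [map_affinePt, line_affinePt]
      exact affineVec_mem_ker_iff.mpr rfl)
    rw [X0_eq, homog_affineVec, Fin.cons_zero] at h
    have := hK.nontrivial
    exact one_ne_zero h
  · intro hp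
    have hJ : (line p).map (X0 n A) = ⊤ := by
      by_contra hne
      obtain ⟨M, hM, hle⟩ := Ideal.exists_le_maximal _ hne
      let K : Alg := CommAlgCat.of ℂ (A ⧸ M)
      let π : A ⟶ K := CommAlgCat.ofHom (Ideal.Quotient.mkₐ ℂ M)
      refine hp K π ((Ideal.Quotient.maximal_ideal_iff_isField_quotient M).mp hM) fun v hv => ?_
      rw [line_map] at hv
      have hspan : Submodule.span K (mapVec π '' line p) ≤ LinearMap.ker (X0 n K) := by
        rw [Submodule.span_le]
        rintro _ ⟨u, hu, rfl⟩
        change X0 n K (mapVec π u) = 0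
        rw [X0_eq, homog_mapVec, ← X0_eq]
        exact Ideal.Quotient.eq_zero_iff_mem.mpr (hle ⟨u, hu, rfl⟩)
      exact hspan hv
    obtain ⟨u, hu, hu1⟩ : (1 : A) ∈ (line p).map (X0 n A) := hJ ▸ Submodule.mem_top
    rw [X0_eq] at hu1
    obtain ⟨z, rfl⟩ := exists_eq_affineVec hu1
    exact ⟨z, (eq_affinePt hu).symm⟩

end Affine

variable {k m : ℕ}

theorem isAffinePoint_iff {A : Alg} (p : (proj (k + m)).obj A) (x : Fin k → A) (y : Fin m → A) :
    IsAffinePoint p x y ↔ p = affinePt (Fin.append x y) := by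
  have h : IsAffinePoint p x y ↔ line p = line (affinePt (Fin.append x y)) := by
    rw [line_affinePt, ker_affineQuot]
    rfl
  rw [h]
  exact ⟨proj_ext, fun h => h ▸ rfl⟩

theorem mem_U_zero_iff {A : Alg} (p : (D (k + m) k 0).obj A) :
    p ∈ (UOpen k m 0).obj A ↔ ∃ z : Fin (k + m) → A, affinePt z = p := by
  refine Iff.trans ?_ (exists_affinePt_iff (n := k + m) p).symm
  constructor
  · intro hp K φ hK h
    exact hp K φ hK 0 le_rfl ⟨rfl, h⟩
  · rintro hp K φ hK s - ⟨-, h⟩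
    exact hp K φ hK h

/-! ### The open sets `U^r` -/

theorem mem_UOpen_of_comp_eq {r : ℕ} {A A' : Alg} (π : A' ⟶ A) (σ : A ⟶ A')
    (h : ∀ (K : Alg) (φ : A' ⟶ K), IsField K → φ = π ≫ σ ≫ φ) (v : (D (k + m) k r).obj A')
    (hv : (D (k + m) k r).map π v ∈ (UOpen k m r).obj A) : v ∈ (UOpen k m r).obj A' := by
  intro K φ hK s hs
  rw [h K φ hK, Functor.map_comp_apply]
  exact hv K (σ ≫ φ) hK s hs

variable (k m) in
/-- A chart of `U^r`, in which the Semple bundle has the equations `dy^j_I = ∑ i, y^j_{I, i} dx_i`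
for the `I` of length less than `r`, and the vertical vectors of the Semple bundle are those with
`dx_i = 0` for all `i`. -/
structure StageChart (r : ℕ) where
  chart : Chart (X := D (k + m) k r) (UOpen k m r) (Coord k m r)
  focal_iff : ∀ {A : Alg} (a w : Coord k m r → A),
    chart.tang a w ∈ (stage (k + m) k r).focal A ↔
      ∀ (s : ℕ) (hs : s + 1 ≤ r) (I : Fin s → Fin k) (j : Fin m),
        w (.y s ((Nat.le_succ s).trans hs) I j) =
          ∑ i, a (.y (s + 1) hs (Fin.snoc I i) j) * w (.x i)
  vertical_iff : ∀ {A : Alg} (a w : Coord k m r → A),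
    chart.tang a w ∈ (stage (k + m) k r).focal A →
      (IsVertical r (chart.tang a w) ↔ ∀ i, w (.x i) = 0)

/-! ### The chart of `U^0` -/

/-- The affine coordinates `(x_1, …, x_k, y_1, …, y_m)` of a point of `U^0`. -/
def affineCoords {A : Alg} (a : Coord k m 0 → A) : Fin (k + m) → A :=
  Fin.append (fun i => a (.x i)) fun j => a (.y 0 le_rfl Fin.elim0 j)

theorem affineCoords_injective {A : Alg} :
    Function.Injective (affineCoords : (Coord k m 0 → A) → Fin (k + m) → A) := by
  intro a a' h
  funext c
  rcases c with i | ⟨s, hs, I, j⟩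
  · simpa [affineCoords] using congrFun h (Fin.castAdd m i)
  · obtain rfl := Nat.le_zero.mp hs
    obtain rfl : I = Fin.elim0 := Subsingleton.elim _ _
    simpa [affineCoords] using congrFun h (Fin.natAdd k j)

theorem exists_affineCoords_eq {A : Alg} (x : Fin k → A) (y : Fin m → A) :
    ∃ a : Coord k m 0 → A, affineCoords a = Fin.append x y ∧ ∀ i, a (.x i) = x i :=
  ⟨fun c => match c with
    | .x i => x i
    | .y _ _ _ j => y j, rfl, fun _ => rfl⟩

variable (k m) in
/-- The affine coordinates of `ℙⁿ` as a chart of `U^0`. -/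
def chartZero : Chart (X := D (k + m) k 0) (UOpen k m 0) (Coord k m 0) where
  pt a := affinePt (affineCoords a)
  map_pt φ a := by
    refine (map_affinePt (n := k + m) φ _).trans ?_
    congr 1
    funext i
    refine Fin.addCases (fun i => ?_) (fun i => ?_) i <;> simp [affineCoords]
  mem_iff p := by
    rw [mem_U_zero_iff]
    constructor
    · rintro ⟨z, rfl⟩
      obtain ⟨a, ha, -⟩ := exists_affineCoords_eq (fun i => z (Fin.castAdd m i))
        fun j => z (Fin.natAdd k j)
      refine ⟨a, ?_⟩
      rw [ha, Fin.append_castAdd_natAdd]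
    · rintro ⟨a, rfl⟩
      exact ⟨_, rfl⟩
  injective {_} _ _ h := affineCoords_injective (affinePt_injective h)
  mem_of_comp_eq := mem_UOpen_of_comp_eq

variable (k m) in
/-- The chart of `U^0`, with its Semple bundle, the whole tangent bundle. -/
def stageChartZero : StageChart k m 0 where
  chart := chartZero k m
  focal_iff a w := ⟨fun _ s hs => absurd hs (Nat.not_succ_le_zero s), fun _ => Set.mem_univ _⟩
  vertical_iff {A} a w _ := by
    have hx : ∀ i, affineCoords (A := dual A)
        (fun c => (inl (a c) + inr (w c) : DualNumber A)) (Fin.castAdd m i) =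
          (inl (a (.x i)) + inr (w (.x i)) : DualNumber A) := fun i => by simp [affineCoords]
    constructor
    · rintro ⟨x, y, h⟩ i
      have h := affinePt_injective ((isAffinePoint_iff _ _ _).mp h)
      have h := congrFun h (Fin.castAdd m i)
      rw [hx, Fin.append_left] at h
      simpa using congrArg TrivSqZeroExt.snd h
    · intro h
      refine ⟨fun i => a (.x i), fun j => affineCoords (A := dual A)
        (fun c => (inl (a c) + inr (w c) : DualNumber A)) (Fin.natAdd k j), ?_⟩
      refine (isAffinePoint_iff _ _ _).mpr (congrArg affinePt ?_)
      funext i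
      refine Fin.addCases (fun i => ?_) (fun j => ?_) i
      · rw [hx, h i, Fin.append_left]
        simp
      · rw [Fin.append_right]

/-! ### Prolongation of charts -/

section Step

variable {r : ℕ} {A B : Alg}

/-- A coordinate of order at most `r` as a coordinate of order at most `r + 1`. -/
def Coord.lift : Coord k m r → Coord k m (r + 1)
  | .x i => .x i
  | .y s hs I j => .y s (hs.trans (Nat.le_succ r)) I j

/-- The derivatives `∂c/∂x_i` of the coordinates of order at most `r`, in terms of the coordinates
of order at most `r + 1`. -/
def slope (a : Coord k m (r + 1) → A) : Coord k m r → Fin k → A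
  | .x i => Pi.single i 1
  | .y s hs I j => fun i => a (.y (s + 1) (Nat.succ_le_succ hs) (Fin.snoc I i) j)

theorem isSlope_slope (a : Coord k m (r + 1) → A) : Chart.IsSlope Coord.x (slope a) :=
  fun _ => rfl

theorem slope_map (φ : A ⟶ B) (a : Coord k m (r + 1) → A) (c : Coord k m r) (i : Fin k) :
    slope (fun c => φ.hom (a c)) c i = φ.hom (slope a c i) := by
  rcases c with i' | ⟨s, hs, I, j⟩
  · change (Pi.single i' 1 : Fin k → B) i = φ.hom ((Pi.single i' 1 : Fin k → A) i)
    rw [Pi.single_apply, Pi.single_apply]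
    split_ifs <;> simp
  · rfl

theorem Coord.eq_lift_or (c : Coord k m (r + 1)) :
    (∃ c' : Coord k m r, c = c'.lift) ∨
      ∃ (I : Fin r → Fin k) (i : Fin k) (j : Fin m), c = .y (r + 1) le_rfl (Fin.snoc I i) j := by
  rcases c with i | ⟨s, hs, I, j⟩
  · exact Or.inl ⟨.x i, rfl⟩
  · rcases Nat.le_succ_iff.mp hs with h | rfl
    · exact Or.inl ⟨.y s h I j, rfl⟩
    · exact Or.inr ⟨Fin.init I, I (Fin.last r), j, by rw [Fin.snoc_init_self]⟩

theorem eq_of_lift_eq_of_slope_eq {a a' : Coord k m (r + 1) → A}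
    (h : ∀ c : Coord k m r, a c.lift = a' c.lift) (h' : ∀ c i, slope a c i = slope a' c i) :
    a = a' := by
  funext c
  rcases c.eq_lift_or with ⟨c', rfl⟩ | ⟨I, i, j, rfl⟩
  · exact h c'
  · exact h' (.y r le_rfl I j) i

/-- The coordinates of order at most `r` and those of order `r + 1` can be prescribed
independently. -/
theorem exists_lift_eq_and_top_eq (a : Coord k m r → A)
    (g : (Fin (r + 1) → Fin k) → Fin m → A) :
    ∃ a' : Coord k m (r + 1) → A, (∀ c, a' (Coord.lift c) = a c) ∧
      ∀ I j, a' (.y (r + 1) le_rfl I j) = g I j := by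
  refine ⟨fun c => match c with
    | .x i => a (.x i)
    | .y s hs I j => if h : s ≤ r then a (.y s h I j)
      else g (fun t => I (Fin.cast (by omega) t)) j, ?_, ?_⟩
  · rintro (i | ⟨s, hs, I, j⟩)
    · rfl
    · exact dif_pos hs
  · intro I j
    exact dif_neg (by omega)

theorem mem_UOpen_succ_iff (p : (D (k + m) k (r + 1)).obj A) :
    p ∈ (UOpen k m (r + 1)).obj A ↔ b p ∈ (UOpen k m r).obj A ∧
      ∀ (K : Alg) (φ : A ⟶ K), IsField K → ¬ InC (r + 1) ((D (k + m) k (r + 1)).map φ p) := by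
  constructor
  · refine fun h => ⟨fun K φ hK s hs hC => h K φ hK s (hs.trans (Nat.le_succ r)) ?_,
      fun K φ hK hC => h K φ hK (r + 1) le_rfl (Or.inl ⟨rfl, hC⟩)⟩
    exact Or.inr ⟨hs, hC⟩
  · rintro ⟨h, h'⟩ K φ hK s hs (⟨-, hC⟩ | ⟨hs', hC⟩)
    · exact h' K φ hK hC
    · exact h K φ hK s hs' hC

namespace StageChart

variable (S : StageChart k m r)

theorem graph_subset_focal (a : Coord k m (r + 1) → A) (φ : A ⟶ B) :
    S.chart.graph (X := stage (k + m) k r) (fun c => a c.lift) (slope a) φ ⊆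
      (stage (k + m) k r).focal B := by
  rintro _ ⟨t, rfl⟩
  refine (S.focal_iff _ _).mpr fun s hs I j => ?_
  refine Finset.sum_congr rfl fun i _ => ?_
  rw [(isSlope_slope a).sum_eq φ t i]
  rfl

/-- The point of `U^{r+1}` with the coordinates `a`: the plane with the equations
`dy^j_I = ∑ i, y^j_{I, i} dx_i`. -/
def nextPt (a : Coord k m (r + 1) → A) : GrPoint (stage (k + m) k r) k A :=
  Chart.graphPoint (X := stage (k + m) k r) S.chart Coord.x (fun c => a c.lift) (slope a)
    (isSlope_slope a) fun _ φ => S.graph_subset_focal a φ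

theorem nextPt_pull (φ : A ⟶ B) (a : Coord k m (r + 1) → A) :
    (S.nextPt a).pull φ = S.nextPt fun c => φ.hom (a c) := by
  apply GrPoint.ext
  · exact S.chart.map_pt φ _
  · funext C ψ
    have h : slope (fun c => φ.hom (a c)) = fun c i => φ.hom (slope a c i) :=
      funext fun c => funext fun i => slope_map φ a c i
    change Chart.graph (X := stage (k + m) k r) S.chart _ (slope a) (φ ≫ ψ) =
      Chart.graph (X := stage (k + m) k r) S.chart _ (slope fun c => φ.hom (a c)) ψ
    rw [h, ← Chart.graph_pull]

theorem nextPt_injective : Function.Injective (S.nextPt (A := A)) := by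
  intro a a' h
  have h1 := S.chart.injective (congrArg GrPoint.base h)
  refine eq_of_lift_eq_of_slope_eq (congrFun h1) fun c i => ?_
  have h2 : S.chart.graph (X := stage (k + m) k r) (fun c => a c.lift) (slope a) (𝟙 A) =
      S.chart.graph (X := stage (k + m) k r) (fun c => a' c.lift) (slope a') (𝟙 A) :=
    congrFun (congrFun (congrArg GrPoint.carrier h) A) (𝟙 A)
  rw [← h1] at h2
  exact Chart.graph_inj (isSlope_slope a) (isSlope_slope a') h2 c i

/-- The points of `U^{r+1}` are the planes `dy^j_I = ∑ i, y^j_{I, i} dx_i` over the points of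
`U^r`. -/
theorem mem_iff_exists_nextPt (p : GrPoint (stage (k + m) k r) k A) :
    p ∈ (UOpen k m (r + 1)).obj A ↔ ∃ a, S.nextPt a = p := by
  refine (mem_UOpen_succ_iff p).trans ?_
  constructor
  · rintro ⟨hb, hC⟩
    obtain ⟨a, ha⟩ := (S.chart.mem_iff _).mp hb
    obtain ⟨N, hN, hgr⟩ := Chart.exists_graph (X := stage (k + m) k r) (χ := S.chart)
      (x := Coord.x) p ha.symm (by
        intro K φ hK w hw hwx
        by_contra hne
        refine hC K φ hK ⟨_, ?_, fun h0 => hne (S.chart.isZeroVector_tang.mp h0),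
          (S.vertical_iff _ w (p.le_focal K φ hw)).mpr hwx⟩
        change _ ∈ p.carrier K (φ ≫ 𝟙 K)
        rwa [Category.comp_id])
    obtain ⟨a', ha', htop⟩ := exists_lift_eq_and_top_eq a
      fun I j => N (.y r le_rfl (Fin.init I) j) (I (Fin.last r))
    -- the lower slopes are coordinates because the plane lies in the Semple bundle
    have hslope : slope a' = N := by
      funext c i
      rcases c with i' | ⟨s, hs, I, j⟩
      · exact (congrFun (hN i') i).symm
      · change a' (.y (s + 1) (Nat.succ_le_succ hs) (Fin.snoc I i) j) = _
        rcases hs.lt_or_eq with h | rfl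
        · have hmem : S.chart.tang a (fun c => ∑ j, N c j * (Pi.single i 1 : Fin k → A) j) ∈
              (stage (k + m) k r).focal A := by
            refine p.le_focal A (𝟙 A) ?_
            rw [hgr]
            exact ⟨Pi.single i 1, rfl⟩
          have h1 := (S.focal_iff _ _).mp hmem s h I j
          have hsum := hN.sum_eq (𝟙 A) (Pi.single i 1)
          have h2 : ∀ i', ∑ j, N (.x i') j * (Pi.single i 1 : Fin k → A) j =
            (Pi.single i 1 : Fin k → A) i' := hsum
          simp only [h2] at h1
          simp only [Pi.single_apply, mul_ite, mul_one, mul_zero, Finset.sum_ite_eq',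
            Finset.mem_univ, if_true] at h1
          exact (ha' (.y (s + 1) h (Fin.snoc I i) j)).trans h1.symm
        · rw [htop, Fin.init_snoc, Fin.snoc_last]
    refine ⟨a', ?_⟩
    have ha'' : (fun c : Coord k m r => a' c.lift) = a := funext ha'
    apply GrPoint.ext
    · change S.chart.pt (fun c : Coord k m r => a' c.lift) = _
      rw [ha'']
      exact ha
    · funext B φ
      change Chart.graph (X := stage (k + m) k r) S.chart (fun c : Coord k m r => a' c.lift)
        (slope a') φ = _
      rw [ha'', hslope, hgr]
  · rintro ⟨a, rfl⟩
    refine ⟨S.chart.pt_mem _, fun K φ hK hC => ?_⟩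
    obtain ⟨v, hv, hne, hvert⟩ := hC
    have hv : v ∈ S.chart.graph (X := stage (k + m) k r) (fun c => a c.lift) (slope a) φ := by
      change v ∈ (S.nextPt a).carrier K (φ ≫ 𝟙 K) at hv
      rwa [Category.comp_id] at hv
    have hF := S.graph_subset_focal a φ hv
    obtain ⟨t, rfl⟩ := hv
    have hx := (S.vertical_iff _ _ hF).mp hvert
    refine hne (S.chart.isZeroVector_tang.mpr (funext fun c => ?_))
    have ht : ∀ i, t i = 0 := fun i => ((isSlope_slope a).sum_eq φ t i).symm.trans (hx i)
    simp [ht]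

/-- The chart of `U^{r+1}` induced by a chart of `U^r`. -/
def nextChart : Chart (X := D (k + m) k (r + 1)) (UOpen k m (r + 1)) (Coord k m (r + 1)) where
  pt a := S.nextPt a
  map_pt φ a := S.nextPt_pull φ a
  mem_iff p := S.mem_iff_exists_nextPt p
  injective {_} _ _ h := S.nextPt_injective h
  mem_of_comp_eq := mem_UOpen_of_comp_eq

theorem b_nextChart_tang (a w : Coord k m (r + 1) → A) :
    b (S.nextChart.tang a w) = S.chart.tang (fun c => a c.lift) (fun c => w c.lift) := rfl

/-- A tangent vector of `U^{r+1}` lies in the Semple bundle when its image in the tangent bundle of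
`U^r` lies in the plane given by the point where it is attached. -/
theorem nextChart_focal_iff (a w : Coord k m (r + 1) → A) :
    S.nextChart.tang a w ∈ (stage (k + m) k (r + 1)).focal A ↔
      ∀ c : Coord k m r, w c.lift = ∑ i, slope a c i * w (.x i) := by
  have h : GrPoint.pull (X := stage (k + m) k r) (S.nextChart.tang a w) (dualFst A) =
      S.nextPt a := S.nextChart.map_dualFst_tang a w
  change b (S.nextChart.tang a w) ∈ (GrPoint.pull (X := stage (k + m) k r)
    (S.nextChart.tang a w) (dualFst A)).carrier A (𝟙 A) ↔ _
  rw [h, b_nextChart_tang]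
  refine (Chart.tang_mem_graph (χ := S.chart) (X := stage (k + m) k r) (φ := 𝟙 A)
    (isSlope_slope a)).trans ?_
  exact ⟨fun h => h.2, fun h => ⟨rfl, h⟩⟩

/-- The prolongation of a chart of `U^r` to a chart of `U^{r+1}`. -/
def next : StageChart k m (r + 1) where
  chart := S.nextChart
  focal_iff a w := by
    rw [nextChart_focal_iff]
    constructor
    · intro h s hs I j
      exact h (.y s (Nat.le_of_succ_le_succ hs) I j)
    · rintro h (i | ⟨s, hs, I, j⟩)
      · exact ((isSlope_slope a).sum_eq (𝟙 _) (fun i => w (.x i)) i).symm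
      · exact h s (Nat.succ_le_succ hs) I j
  vertical_iff a w hF := by
    rw [nextChart_focal_iff] at hF
    change IsZeroVector (b (S.nextChart.tang a w)) ↔ _
    rw [b_nextChart_tang, Chart.isZeroVector_tang]
    constructor
    · intro h i
      exact congrFun h (.x i)
    · intro h
      funext c
      rw [hF c]
      simp [h]

end StageChart

end Step

variable (k m) in
/-- The charts of the open sets `U^r`. -/
def stageChart : ∀ r, StageChart k m r
  | 0 => stageChartZero k m
  | r + 1 => (stageChart r).next

/-! ### The trivialisations -/

namespace Chart

variable {X : Space} {V : Subfunctor X} {ι : Type} (χ : Chart V ι) {A B : Alg}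

/-- The coordinates of a point of `V`. -/
def coords (p : V.obj A) : ι → A := ((χ.mem_iff p.1).mp p.2).choose

theorem pt_coords (p : V.obj A) : χ.pt (χ.coords p) = p.1 := ((χ.mem_iff p.1).mp p.2).choose_spec

theorem coords_eq_iff {p : V.obj A} {a : ι → A} : χ.coords p = a ↔ p.1 = χ.pt a := by
  rw [← χ.pt_coords p, χ.injective.eq_iff]

/-- The bijection of the `A`-valued points of `V` with `A^ι`. -/
def equiv (A : Alg) : V.obj A ≃ (ι → A) where
  toFun := χ.coords
  invFun a := ⟨χ.pt a, χ.pt_mem a⟩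
  left_inv p := Subtype.ext (χ.pt_coords p)
  right_inv _ := χ.coords_eq_iff.mpr rfl

theorem coords_map (φ : A ⟶ B) (p : V.toFunctor.obj A) :
    χ.coords (V.toFunctor.map φ p) = fun c => φ.hom (χ.coords p c) := by
  refine χ.coords_eq_iff.mpr ?_
  exact (congrArg (X.map φ) (χ.pt_coords p).symm).trans (χ.map_pt φ _)

/-- A chart as an isomorphism of functors. -/
def iso : V.toFunctor ≅ affineSpace ι :=
  NatIso.ofComponents (fun A => ((χ.equiv A).trans Equiv.ulift.symm).toIso) fun {A B} φ => by
    ext p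
    exact congrArg ULift.up (χ.coords_map φ p)

end Chart

/-- A linear map from a tensor power of `ℂ^k` to `ℂ^m` is determined by its matrix entries, which
are arbitrary. -/
def homSpaceEquiv (k m s : ℕ) : HomSpace k m s ≃ₗ[ℂ] ((Fin s → Fin k) × Fin m → ℂ) :=
  LinearEquiv.ofBijective (LinearMap.pi fun c => entry c.1 c.2) <| by
    let β := Basis.piTensorProduct fun _ : Fin s => Pi.basisFun ℂ (Fin k)
    have hβ : ∀ I, β I = PiTensorProduct.tprod ℂ fun t => (Pi.single (I t) 1 : Fin k → ℂ) := by
      intro I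
      simp [β]
    constructor
    · intro h h' hh
      refine β.ext fun I => funext fun j => ?_
      rw [hβ]
      exact congrFun hh (I, j)
    · intro g
      refine ⟨β.constr ℂ fun I j => g (I, j), funext fun c => ?_⟩
      change β.constr ℂ (fun I j => g (I, j)) (PiTensorProduct.tprod ℂ _) c.2 = _
      rw [← hβ, Module.Basis.constr_basis]

/-- The points of `Hom((ℂ^k)^{⊗ s}, ℂ^m)` with values in `A` are given by their matrix entries. -/
def entryEquiv (A : Alg) (k m s : ℕ) :
    A ⊗[ℂ] HomSpace k m s ≃ₗ[ℂ] ((Fin s → Fin k) × Fin m → A) :=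
  (homSpaceEquiv k m s).lTensor A ≪≫ₗ
    (TensorProduct.piScalarRight ℂ ℂ A ((Fin s → Fin k) × Fin m))

theorem entryEquiv_apply {A : Alg} {s : ℕ} (h : A ⊗[ℂ] HomSpace k m s) (I : Fin s → Fin k)
    (j : Fin m) : entryEquiv A k m s h (I, j) = entryOver I j h := by
  induction h with
  | zero => simp [entryOver]
  | tmul a h =>
    change entry I j h • a = _
    simp [entryOver]
  | add u v hu hv =>
    rw [map_add, Pi.add_apply, hu, hv]
    simp [entryOver]

theorem entryOver_map {A B : Alg} (φ : A ⟶ B) {s : ℕ} (I : Fin s → Fin k) (j : Fin m)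
    (h : A ⊗[ℂ] HomSpace k m s) :
    entryOver I j (LinearMap.rTensor (HomSpace k m s) φ.hom.toLinearMap h) =
      φ.hom (entryOver I j h) := by
  induction h with
  | zero => simp [entryOver]
  | tmul a h => simp [entryOver]
  | add u v hu hv =>
    simp only [entryOver, map_add] at hu hv ⊢
    rw [hu, hv]

section Split

variable {r : ℕ} {A : Alg}

/-- The splitting of the coordinates of order at most `r + 1` into those of order at most `r` and
those of order `r + 1`. -/
def splitCoords (A : Alg) (r : ℕ) : (Coord k m (r + 1) → A) ≃
    (Coord k m r → A) × ((Fin (r + 1) → Fin k) × Fin m → A) :=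
  Equiv.ofBijective (fun a => (fun c => a c.lift, fun c => a (.y (r + 1) le_rfl c.1 c.2))) <| by
    constructor
    · intro a a' h
      have h1 := congrFun (congrArg Prod.fst h)
      have h2 := congrFun (congrArg Prod.snd h)
      funext c
      rcases c.eq_lift_or with ⟨c', rfl⟩ | ⟨I, i, j, rfl⟩
      · exact h1 c'
      · exact h2 (Fin.snoc I i, j)
    · rintro ⟨a, g⟩
      obtain ⟨a', h, h'⟩ := exists_lift_eq_and_top_eq a fun I j => g (I, j)
      exact ⟨a', Prod.ext (funext h) (funext fun c => h' c.1 c.2)⟩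

namespace StageChart

variable (S : StageChart k m r)

theorem b_mem (p : (UOpen k m (r + 1)).obj A) : b p.1 ∈ (UOpen k m r).obj A :=
  ((mem_UOpen_succ_iff p.1).mp p.2).1

theorem coords_b (p : (UOpen k m (r + 1)).obj A) (c : Coord k m r) :
    S.chart.coords ⟨b p.1, b_mem p⟩ c = S.next.chart.coords p c.lift := by
  refine congrFun (S.chart.coords_eq_iff (a := fun c => S.next.chart.coords p c.lift) |>.mpr ?_) c
  change b p.1 = _
  rw [← S.next.chart.pt_coords p]
  rfl

/-- The `A`-valued points of `U^{r+1}` are the pairs of a point of `U^r` and a family of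
coordinates of order `r + 1`. -/
def trivEquiv (A : Alg) : (UOpen k m (r + 1)).obj A ≃
    (UOpen k m r).obj A × ULift.{1} (A ⊗[ℂ] HomSpace k m (r + 1)) :=
  ((S.next.chart.equiv A).trans (splitCoords A r)).trans <|
    (S.chart.equiv A).symm.prodCongr ((entryEquiv A k m (r + 1)).symm.toEquiv.trans
      Equiv.ulift.symm)

theorem trivEquiv_fst (p : (UOpen k m (r + 1)).obj A) :
    (S.trivEquiv A p).1 = ⟨b p.1, b_mem p⟩ := by
  refine (Equiv.symm_apply_eq _).mpr (funext fun c => ?_)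
  exact (S.coords_b p c).symm

theorem entryOver_trivEquiv (p : (UOpen k m (r + 1)).obj A) (I : Fin (r + 1) → Fin k)
    (j : Fin m) : entryOver I j (S.trivEquiv A p).2.down =
      S.next.chart.coords p (.y (r + 1) le_rfl I j) := by
  rw [← entryEquiv_apply]
  exact congrFun ((entryEquiv A k m (r + 1)).apply_symm_apply _) (I, j)

/-- The isomorphism `U^{r+1} ≅ U^r × Hom((ℂ^k)^{⊗ (r+1)}, ℂ^m)`. -/
def triv : U k m (r + 1) ≅
    FunctorToTypes.prod (U k m r) (vectorSpace (HomSpace k m (r + 1))) :=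
  NatIso.ofComponents (fun A => (S.trivEquiv A).toIso) fun {A B} φ => by
    refine ConcreteCategory.hom_ext _ _ fun p => ?_
    refine Prod.ext ?_ (ULift.ext _ _ ((entryEquiv B k m (r + 1)).injective (funext fun c => ?_)))
    · refine (S.trivEquiv_fst _).trans ?_
      exact (congrArg ((UOpen k m r).toFunctor.map φ) (S.trivEquiv_fst p)).symm
    · rw [entryEquiv_apply, entryEquiv_apply]
      refine (S.entryOver_trivEquiv _ _ _).trans ?_
      refine Eq.trans ?_ (entryOver_map φ c.1 c.2 (S.trivEquiv A p).2.down).symm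
      refine Eq.trans ?_ (congrArg φ.hom (S.entryOver_trivEquiv p c.1 c.2)).symm
      exact congrFun (S.next.chart.coords_map φ p) _

theorem mem_plane_iff (p : (UOpen k m (r + 1)).obj A) (v : (D (k + m) k r).obj (dual A)) :
    v ∈ plane p.1 ↔ ∃ hv : v ∈ (UOpen k m r).obj (dual A),
      (D (k + m) k r).map (dualFst A) v = b p.1 ∧
      ∀ (s : ℕ) (hs : s ≤ r) (I : Fin s → Fin k) (j : Fin m),
        TrivSqZeroExt.snd (S.chart.coords (A := dual A) ⟨v, hv⟩ (.y s hs I j)) =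
          ∑ i : Fin k,
            S.next.chart.coords p (.y (s + 1) (Nat.succ_le_succ hs) (Fin.snoc I i) j) *
              TrivSqZeroExt.snd (S.chart.coords (A := dual A) ⟨v, hv⟩ (.x i)) := by
  set a := S.next.chart.coords p with ha
  have hb : b p.1 = S.chart.pt (fun c => a c.lift) :=
    (S.chart.coords_eq_iff (p := ⟨b p.1, b_mem p⟩)).mp (funext fun c => S.coords_b p c)
  have hplane : plane p.1 = S.chart.graph (X := stage (k + m) k r) (fun c => a c.lift)
      (slope a) (𝟙 A) := by
    rw [← S.next.chart.pt_coords p]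
    rfl
  have hcoords : ∀ (a' w : Coord k m r → A) (h : S.chart.tang a' w ∈ (UOpen k m r).obj (dual A))
      (c : Coord k m r),
      TrivSqZeroExt.snd (S.chart.coords (A := dual A) ⟨S.chart.tang a' w, h⟩ c) = w c := by
    intro a' w h c
    rw [S.chart.coords_eq_iff.mpr
      (show S.chart.tang a' w = S.chart.pt (A := dual A)
        (fun c => (inl (a' c) + inr (w c) : DualNumber A)) from rfl)]
    simp
  rw [hplane]
  constructor
  · intro hv
    have hv' := hv
    obtain ⟨t, rfl⟩ := hv'
    refine ⟨S.chart.tang_mem _ _, ?_, fun s hs I j => ?_⟩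
    · rw [hb]
      exact S.chart.map_dualFst_tang _ _
    · simp only [hcoords]
      exact ((Chart.tang_mem_graph (X := stage (k + m) k r) (isSlope_slope a)).mp hv).2
        (.y s hs I j)
  · rintro ⟨hv, hbase, h⟩
    rw [hb] at hbase
    obtain ⟨w, rfl⟩ := S.chart.exists_tang hbase
    simp only [hcoords] at h
    refine (Chart.tang_mem_graph (X := stage (k + m) k r) (isSlope_slope a)).mpr ⟨rfl, ?_⟩
    rintro (i | ⟨s, hs, I, j⟩)
    · exact ((isSlope_slope a).sum_eq (𝟙 A) (fun i => w (.x i)) i).symm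
    · exact h s hs I j

end StageChart

end Split

end DataScheme

end

theorem mainTheorem10 (k m : ℕ) (hk : 1 ≤ k) (hm : 1 ≤ m) :
    ∃ (Φ : ∀ r : ℕ, U k m r ≅ affineSpace (Coord k m r))
      (Ψ : ∀ r : ℕ, U k m (r + 1) ≅
        FunctorToTypes.prod (U k m r) (vectorSpace (HomSpace k m (r + 1)))),
      -- the coordinates of `U^0` are the given affine coordinates
      (∀ (A : Alg) (p : (U k m 0).obj A),
        IsAffinePoint p.1 (fun i => coord (Φ 0) p (.x i))
          (fun j => coord (Φ 0) p (.y 0 le_rfl Fin.elim0 j))) ∧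
      -- the first component of the trivialisation is the projection of the data schemes
      (∀ (r : ℕ) (A : Alg) (p : (U k m (r + 1)).obj A),
        ((Ψ r).hom.app A p).1.1 = b p.1) ∧
      -- the coordinates of order at most `r` are pulled back from `U^r`
      (∀ (r : ℕ) (A : Alg) (p : (U k m (r + 1)).obj A),
        (∀ i, coord (Φ (r + 1)) p (.x i) = coord (Φ r) ((Ψ r).hom.app A p).1 (.x i)) ∧
        (∀ (s : ℕ) (hs : s ≤ r) (I : Fin s → Fin k) (j : Fin m),
          coord (Φ (r + 1)) p (.y s (hs.trans (Nat.le_succ r)) I j) =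
            coord (Φ r) ((Ψ r).hom.app A p).1 (.y s hs I j))) ∧
      -- the coordinates of order `r + 1` are the entries of the second component
      (∀ (r : ℕ) (A : Alg) (p : (U k m (r + 1)).obj A) (I : Fin (r + 1) → Fin k) (j : Fin m),
        coord (Φ (r + 1)) p (.y (r + 1) le_rfl I j) =
          entryOver I j ((Ψ r).hom.app A p).2.down) ∧
      -- `y^j_{i_1, …, i_s, i}` is the derivative of `y^j_{i_1, …, i_s}` with respect to `x_i`:
      -- the `k`-plane given by `p` has the equations `d y^j_I = ∑ i, y^j_{I, i} d x_i`
      (∀ (r : ℕ) (A : Alg) (p : (U k m (r + 1)).obj A) (v : (D (k + m) k r).obj (dual A)),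
        v ∈ plane p.1 ↔
          ∃ hv : v ∈ (UOpen k m r).obj (dual A),
            (D (k + m) k r).map (dualFst A) v = b p.1 ∧
            ∀ (s : ℕ) (hs : s ≤ r) (I : Fin s → Fin k) (j : Fin m),
              (coord (Φ r) (A := dual A) ⟨v, hv⟩ (.y s hs I j)).snd =
                ∑ i : Fin k,
                  coord (Φ (r + 1)) p (.y (s + 1) (Nat.succ_le_succ hs) (Fin.snoc I i) j) *
                    (coord (Φ r) (A := dual A) ⟨v, hv⟩ (.x i)).snd) := by
  refine ⟨fun r => (stageChart k m r).chart.iso, fun r => (stageChart k m r).triv,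
    fun A p => ?_, fun r A p => ?_, fun r A p => ⟨fun i => ?_, fun s hs I j => ?_⟩,
    fun r A p I j => ?_, fun r A p v => ?_⟩
  · exact (isAffinePoint_iff _ _ _).mpr ((chartZero k m).pt_coords p).symm
  · exact congrArg Subtype.val ((stageChart k m r).trivEquiv_fst p)
  · refine ((stageChart k m r).coords_b p (.x i)).symm.trans ?_
    rw [← (stageChart k m r).trivEquiv_fst p]
    rfl
  · refine ((stageChart k m r).coords_b p (.y s hs I j)).symm.trans ?_
    rw [← (stageChart k m r).trivEquiv_fst p]
    rfl
  · exact ((stageChart k m r).entryOver_trivEquiv p I j).symm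
  · exact (stageChart k m r).mem_plane_iff p v
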